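/- Let $V$ be a complex vector space of finite dimension $n$ with a nondegenerate symmetric bilinear form $(\cdot|\cdot)$. Let $S^3V\subseteq V\otimes V\otimes V$ be the space of symmetric tensors. For $T\in S^3V$ let $\mu_T:V\times V\to V$ be the bilinear map obtained by contracting the first two factors of $T$ with the arguments by means of the form, so that $\mu_{v^{\otimes 3}}(x,y)=(v|x)(v|y)\,v$. Let $$X(V)=\{T\in S^3V \mid \mu_T(x,\mu_T(y,z))=\mu_T(\mu_T(x,y),z)\ \text{for all } x,y,z\in V\},$$ the affine variety cut out by these quadratic equations (Robeva's equations). Call $T$ strongly odeco if $T=\sum_{i=1}^k v_i^{\otimes 3}$ for some $k\ge 0$ and pairwise orthogonal $v_1,\dots,v_k\in V$ with $(v_i|v_i)\neq 0$ for all $i$, and let $Y(V)\subseteq S^3V$ be the Zariski closure of the set of strongly odeco tensors. **Proposition.** $Y(V)$ is contained in $X(V)$ and is an irreducible component of $X(V)$. Moreover $\dim Y(V)=\binom{n+1}{2}$, and for every orthonormal basis $e_1,\dots,e_n$ of $V$ the tangent space of $X(V)$ at $E=\sum_{i=1}^n e_i^{\otimes 3}$, that is, the space of all $D\in S^3V$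 such that $E+\varepsilon D$ satisfies Robeva's equations modulo $\varepsilon^2$, has dimension $\binom{n+1}{2}$. -/

import Mathlib

open scoped TensorProduct

noncomputable section

namespace Odeco

/-! ### Affine algebraic geometry on a complex vector space -/

section Zariski

variable (W : Type*) [AddCommGroup W] [Module ℂ W]

/-- The algebra of polynomial functions on a complex vector space `W`: the subalgebra of all
functions `W → ℂ` generated by the linear functionals. -/
def polynomialFunctions : Subalgebra ℂ (W → ℂ) :=
  Algebra.adjoin ℂ (Set.range fun φ : Module.Dual ℂ W => (φ : W → ℂ))

/-- The common zero locus of a set of functions. -/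
def zeroLocus {W : Type*} (S : Set (W → ℂ)) : Set W := {w | ∀ f ∈ S, f w = 0}

/-- The Zariski topology on `W`: the closed sets are the common zero loci of sets of polynomial
functions. -/
@[reducible] def zariskiTopology : TopologicalSpace W :=
  TopologicalSpace.ofClosed
    {Z | ∃ S : Set (W → ℂ), S ⊆ polynomialFunctions W ∧ Z = zeroLocus S}
    ⟨{1}, by simp, by
      ext w; simp [zeroLocus]⟩
    (by
      intro A hA
      refine ⟨{f | f ∈ polynomialFunctions W ∧ ∃ Z ∈ A, ∀ w ∈ Z, f w = 0}, fun f hf => hf.1, ?_⟩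
      ext w
      simp only [Set.mem_sInter, zeroLocus, Set.mem_ofPred_eq]
      constructor
      · rintro h f ⟨-, Z, hZ, hf⟩
        exact hf w (h Z hZ)
      · intro h Z hZ
        obtain ⟨S, hS, rfl⟩ := hA hZ
        intro f hf
        exact h f ⟨hS hf, _, hZ, fun v hv => hv f hf⟩)
    (by
      rintro _ ⟨S, hS, rfl⟩ _ ⟨S', hS', rfl⟩
      refine ⟨{h | ∃ f ∈ S, ∃ g ∈ S', h = f * g}, ?_, ?_⟩
      · rintro _ ⟨f, hf, g, hg, rfl⟩
        exact mul_mem (hS hf) (hS' hg)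
      · ext w
        constructor
        · rintro (h | h) _ ⟨f, hf, g, hg, rfl⟩
          · simp [h f hf]
          · simp [h g hg]
        · intro h
          by_contra hw
          simp only [Set.mem_union, not_or, zeroLocus, Set.mem_ofPred_eq, not_forall] at hw
          obtain ⟨⟨f, hf, hfw⟩, g, hg, hgw⟩ := hw
          exact mul_ne_zero hfw hgw (h _ ⟨f, hf, g, hg, rfl⟩))

variable {W}

/-- The Zariski closure of a subset of `W`. -/
def zariskiClosure (S : Set W) : Set W := @closure W (zariskiTopology W) S

/-- `Y ⊆ X`, and `Y` is an irreducible component of `X`, where `X` carries the topology induced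
by the Zariski topology of `W`. -/
def IsIrreducibleComponentOf (Y X : Set W) : Prop :=
  letI : TopologicalSpace W := zariskiTopology W
  Y ⊆ X ∧ {x : X | (x : W) ∈ Y} ∈ irreducibleComponents X

/-- The coordinate ring of `Z ⊆ W`: the functions on `Z` that are restrictions of polynomial
functions on `W`. -/
def coordinateRing (Z : Set W) : Subalgebra ℂ (Z → ℂ) :=
  Algebra.adjoin ℂ (Set.range fun (φ : Module.Dual ℂ W) (z : Z) => φ z)

/-- The dimension of a (Zariski closed) set `Z`: the Krull dimension of its coordinate ring. -/
def varietyDim (Z : Set W) : WithBot ℕ∞ := ringKrullDim (coordinateRing Z)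

end Zariski

/-! ### Symmetric tensors and their algebras -/

section Tensors

variable (V : Type*) [AddCommGroup V] [Module ℂ V]

/-- The space `S³V ⊆ V ⊗ V ⊗ V` of symmetric tensors: those fixed by the transposition of the
first two factors and by the transposition of the last two factors. -/
def symCube : Submodule ℂ (V ⊗[ℂ] (V ⊗[ℂ] V)) where
  carrier := {T | TensorProduct.leftComm ℂ V V V T = T ∧
    LinearMap.lTensor V (TensorProduct.comm ℂ V V).toLinearMap T = T}
  add_mem' := by
    rintro a b ⟨ha, ha'⟩ ⟨hb, hb'⟩
    exact ⟨by rw [map_add, ha, hb], by rw [map_add, ha', hb']⟩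
  zero_mem' := ⟨map_zero _, map_zero _⟩
  smul_mem' := by
    rintro c a ⟨ha, ha'⟩
    exact ⟨by rw [map_smul, ha], by rw [map_smul, ha']⟩

variable {V}

/-- The symmetric tensor `v ⊗ v ⊗ v`. -/
def cube (v : V) : symCube V := ⟨v ⊗ₜ[ℂ] (v ⊗ₜ[ℂ] v), by simp [symCube]⟩

variable (B : LinearMap.BilinForm ℂ V)

/-- Contraction of the first tensor factor with `x` by means of the form: on pure tensors
`v ⊗ m ↦ (v|x) m`. -/
def contract (M : Type*) [AddCommGroup M] [Module ℂ M] (x : V) : V ⊗[ℂ] M →ₗ[ℂ] M :=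
  (TensorProduct.lid ℂ M).toLinearMap ∘ₗ LinearMap.rTensor M (B.flip x)

theorem contract_tmul (M : Type*) [AddCommGroup M] [Module ℂ M] (x v : V) (m : M) :
    contract B M x (v ⊗ₜ[ℂ] m) = B v x • m := by
  simp [contract]

/-- The multiplication `μ_T : V × V → V` of a tensor `T`; on pure tensors
`μ_{u ⊗ v ⊗ w}(x, y) = (u|x) (v|y) w`. -/
def mu (T : symCube V) (x y : V) : V :=
  contract B V y (contract B (V ⊗[ℂ] V) x (T : V ⊗[ℂ] (V ⊗[ℂ] V)))

theorem mu_cube (v x y : V) : mu B (cube v) x y = (B v x * B v y) • v := by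
  simp [mu, cube, contract_tmul, smul_smul]

theorem mu_add_left (S T : symCube V) (x y : V) : mu B (S + T) x y = mu B S x y + mu B T x y := by
  simp [mu]

theorem mu_smul_left (c : ℂ) (T : symCube V) (x y : V) : mu B (c • T) x y = c • mu B T x y := by
  simp [mu]

theorem mu_add_fst (T : symCube V) (x x' y : V) :
    mu B T (x + x') y = mu B T x y + mu B T x' y := by
  simp [mu, contract, LinearMap.rTensor_add]

theorem mu_smul_fst (c : ℂ) (T : symCube V) (x y : V) : mu B T (c • x) y = c • mu B T x y := by
  simp [mu, contract, LinearMap.rTensor_smul]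

theorem mu_add_snd (T : symCube V) (x y y' : V) :
    mu B T x (y + y') = mu B T x y + mu B T x y' := by
  simp [mu, contract, LinearMap.rTensor_add]

theorem mu_smul_snd (c : ℂ) (T : symCube V) (x y : V) : mu B T x (c • y) = c • mu B T x y := by
  simp [mu, contract, LinearMap.rTensor_smul]

/-- The variety `X(V) ⊆ S³V` of all `T` with associative `μ_T`, that is, the zero set of Robeva's
quadratic equations. -/
def X : Set (symCube V) := {T | ∀ x y z : V, mu B T x (mu B T y z) = mu B T (mu B T x y) z}

/-- `T` is strongly odeco: a finite sum of cubes of pairwise orthogonal vectors `vᵢ` with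
`(vᵢ|vᵢ) ≠ 0`. -/
def IsStronglyOdeco (T : symCube V) : Prop :=
  ∃ (k : ℕ) (v : Fin k → V), (∀ i, B (v i) (v i) ≠ 0) ∧ (∀ i j, i ≠ j → B (v i) (v j) = 0) ∧
    T = ∑ i, cube (v i)

/-- `Y(V) ⊆ S³V`, the Zariski closure of the set of strongly odeco tensors. -/
def Y : Set (symCube V) := zariskiClosure {T : symCube V | IsStronglyOdeco B T}

/-- The associator `μ_T(x, μ_T(y, z)) - μ_T(μ_T(x, y), z)`; Robeva's equations say that it
vanishes. -/
def robeva (T : symCube V) (x y z : V) : V :=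
  mu B T x (mu B T y z) - mu B T (mu B T x y) z

/-- The differential of `T ↦ robeva B T x y z` at `T`, applied to `D`. -/
def robevaDiff (T D : symCube V) (x y z : V) : V :=
  (mu B D x (mu B T y z) + mu B T x (mu B D y z)) -
    (mu B D (mu B T x y) z + mu B T (mu B D x y) z)

/-- `robevaDiff` is the coefficient of `ε` in Robeva's equations for `T + ε D`. -/
theorem robeva_add_smul (T D : symCube V) (ε : ℂ) (x y z : V) :
    robeva B (T + ε • D) x y z =
      robeva B T x y z + ε • robevaDiff B T D x y z + ε ^ 2 • robeva B D x y z := by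
  simp only [robeva, robevaDiff, mu_add_left, mu_smul_left, mu_add_fst, mu_add_snd, mu_smul_fst,
    mu_smul_snd]
  module

/-- The tangent space at `T` of the variety defined by Robeva's equations: all `D ∈ S³V` such that
`T + ε D` satisfies the equations to first order in `ε`. -/
def tangentSpaceX (T : symCube V) : Submodule ℂ (symCube V) where
  carrier := {D | ∀ x y z : V, robevaDiff B T D x y z = 0}
  add_mem' := by
    intro D D' h h' x y z
    have e : robevaDiff B T (D + D') x y z
        = robevaDiff B T D x y z + robevaDiff B T D' x y z := by
      simp only [robevaDiff, mu_add_left, mu_add_fst, mu_add_snd]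
      abel
    rw [e, h, h', add_zero]
  zero_mem' := by
    intro x y z
    have e : ∀ u v : V, mu B 0 u v = 0 := by intro u v; simp [mu]
    have e₁ : ∀ v : V, mu B T 0 v = 0 := by
      intro v; simpa using mu_smul_fst B 0 T 0 v
    have e₂ : ∀ v : V, mu B T v 0 = 0 := by
      intro v; simpa using mu_smul_snd B 0 T v 0
    simp [robevaDiff, e, e₁, e₂]
  smul_mem' := by
    intro c D h x y z
    have e : robevaDiff B T (c • D) x y z = c • robevaDiff B T D x y z := by
      simp only [robevaDiff, mu_smul_left, mu_smul_fst, mu_smul_snd]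
      module
    rw [e, h, smul_zero]

end Tensors

end Odeco

end

/-! ### Krull dimension and transcendence degree -/

section KrullDimension

/-! The whole proof rests on the trilinear form `(μ_T(x,y)|z)`, which is totally symmetric
(`mu_comm`, `form_mu_right_comm`) and whose values on an orthonormal basis are the coordinates of
`T`.

Component: if `T` is in `X` and some `L = μ_T(x,·)` has distinct eigenvalues, then `L` is
self-adjoint, so it has an orthonormal eigenbasis; associativity makes `L` commute with
multiplication, which forces `T` to be diagonal in that basis
(`isStronglyOdeco_of_charpolyDisc_ne_zero`). For fixed `x`, distinctness of eigenvalues is the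
nonvanishing of a polynomial in `T`, and `x` can be chosen so that it is nonzero at `E`. Hence `X`
is covered by `Y` and a closed set missing `E`, and an irreducible subset of `X` containing `Y` must
lie in `Y`.

Irreducibility and dimension: Cayley transforms of skew-symmetric matrices, cleared of denominators,
together with `n` coefficients give a polynomial map `odecoParam` from affine space of dimension
`binom(n+1,2)`. Every strongly odeco tensor is in its image, and its generic value is strongly
odeco. So `Y` is the closure of the image, hence irreducible, and its coordinate ring embeds in a
polynomial ring, which bounds the dimension above. The coordinates `T_iij` with `i ≤ j` are
algebraically independent on `Y`, because a derivative at `E` is invertible, which gives the lower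
bound.

The tangent space is a separate computation: the linearized equations at `E` are solved in
coordinates (`finrank_tangentSpaceX`). -/

theorem exists_ltSeries_over_of_isIntegral {A R : Type*} [CommRing A] [CommRing R] [Algebra A R]
    [Algebra.IsIntegral A R] (p : LTSeries (PrimeSpectrum A)) :
    ∀ Q : PrimeSpectrum R, PrimeSpectrum.comap (algebraMap A R) Q = p.head →
      ∃ q : LTSeries (PrimeSpectrum R), q.head = Q ∧ q.length = p.length := by
  induction p using RelSeries.inductionOn with
  | singleton x => exact fun Q _ => ⟨RelSeries.singleton _ Q, rfl, rfl⟩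
  | cons p x hx ih =>
    intro Q hQ
    rw [RelSeries.head_cons] at hQ
    have hlt : x < p.head := hx
    -- Going up: the chain is lifted one prime at a time, starting from the prescribed `Q`.
    obtain ⟨Q', hQQ', hQ'p, hQ'⟩ := Ideal.exists_ideal_over_prime_of_isIntegral_of_isPrime
      p.head.asIdeal Q.asIdeal (by
        have := hlt.le
        rw [← hQ] at this
        exact this)
    obtain ⟨q, hq, hql⟩ := ih ⟨Q', hQ'p⟩ (PrimeSpectrum.ext hQ')
    have hne : Q < q.head := by
      rw [hq]
      refine lt_of_le_of_ne hQQ' ?_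
      rintro rfl
      have : x = p.head := hQ.symm.trans (PrimeSpectrum.ext hQ')
      exact hlt.ne this
    exact ⟨q.cons Q hne, by simp, by simp [hql]⟩

/-- Incomparability makes contraction of primes strictly monotone, which gives `≤`; lying over and
going up lift every chain, which gives `≥`. -/
theorem ringKrullDim_eq_of_isIntegral {A R : Type*} [CommRing A] [CommRing R] [Algebra A R]
    [Algebra.IsIntegral A R] (hinj : Function.Injective (algebraMap A R)) :
    ringKrullDim R = ringKrullDim A := by
  refine le_antisymm ?_ ?_
  · refine Order.krullDim_le_of_strictMono (PrimeSpectrum.comap (algebraMap A R)) ?_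
    intro P Q hPQ
    exact Ideal.IsIntegral.comap_lt_comap hPQ
  · refine iSup_le fun p => ?_
    obtain ⟨Q, -, hQp, hQ⟩ := Ideal.exists_ideal_over_prime_of_isIntegral (S := R)
      p.head.asIdeal ⊥ (by
        rw [Ideal.comap_bot_of_injective _ hinj]; exact bot_le)
    obtain ⟨q, -, hq⟩ := exists_ltSeries_over_of_isIntegral p ⟨Q, hQp⟩ (PrimeSpectrum.ext hQ)
    rw [← hq]
    exact le_iSup (fun q : LTSeries (PrimeSpectrum R) => ((q.length : ℕ∞) : WithBot ℕ∞)) q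

/-- Noether normalization: the variables of the polynomial subring over which `R` is integral form
another transcendence basis, so there are as many of them as there are `x i`. -/
theorem ringKrullDim_eq_card_of_isTranscendenceBasis {k R ι : Type*} [Field k] [CommRing R]
    [IsDomain R] [Algebra k R] [Algebra.FiniteType k R] [Fintype ι] {x : ι → R}
    (hx : IsTranscendenceBasis k x) : ringKrullDim R = (Fintype.card ι : WithBot ℕ∞) := by
  obtain ⟨s, g, hg, hint⟩ := exists_integral_inj_algHom_of_fg k R
  let _ := g.toRingHom.toAlgebra
  have : Algebra.IsIntegral (MvPolynomial (Fin s) k) R := ⟨hint⟩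
  have : IsScalarTower k (MvPolynomial (Fin s) k) R :=
    IsScalarTower.of_algebraMap_eq fun r => (g.commutes r).symm
  rw [ringKrullDim_eq_of_isIntegral (A := MvPolynomial (Fin s) k) (R := R) hg,
    MvPolynomial.ringKrullDim_of_isNoetherianRing, ringKrullDim_eq_zero_of_field]
  have : FaithfulSMul (MvPolynomial (Fin s) k) R := (faithfulSMul_iff_algebraMap_injective _ _).mpr hg
  have hb := (IsTranscendenceBasis.mvPolynomial (Fin s) k).algebraMap_comp (A := R)
  have := hx.lift_cardinalMk_eq hb
  simp at this
  simp [this]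

/-- A finitely generated domain of transcendence degree at most `#ι` which contains an algebraically
independent family indexed by `ι` has Krull dimension `#ι`. -/
theorem ringKrullDim_eq_card_of_algebraicIndependent {k R S ι : Type*} [Field k] [CommRing R]
    [IsDomain R] [Algebra k R] [Algebra.FiniteType k R] [CommRing S] [Algebra k S] [Fintype ι]
    (f : R →ₐ[k] S) (hf : Function.Injective f)
    (g : MvPolynomial ι k →ₐ[k] S) (hg : Function.Surjective g)
    {x : ι → R} (hx : AlgebraicIndependent k x) :
    ringKrullDim R = (Fintype.card ι : WithBot ℕ∞) := by
  refine ringKrullDim_eq_card_of_isTranscendenceBasis (k := k) (x := x) ?_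
  refine hx.isTranscendenceBasis_of_lift_trdeg_le_of_finite ?_
  have h₁ := lift_trdeg_le_of_injective f hf
  have h₂ := lift_trdeg_le_of_surjective g hg
  rw [MvPolynomial.trdeg_of_isDomain] at h₂
  simp only [Cardinal.mk_fintype, Cardinal.lift_natCast, Cardinal.lift_le_nat_iff] at h₁ h₂ ⊢
  have h₃ := h₁.trans (Cardinal.lift_le.mpr h₂)
  simpa using h₃

end KrullDimension

namespace Odeco

/-! ### Polynomial functions, Zariski closure and coordinate rings -/

section PolynomialFunctions

variable {W : Type*} [AddCommGroup W] [Module ℂ W]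

theorem dual_mem_polynomialFunctions (φ : Module.Dual ℂ W) :
    (fun w => φ w) ∈ polynomialFunctions W :=
  Algebra.subset_adjoin ⟨φ, rfl⟩

theorem const_mem_polynomialFunctions (c : ℂ) : (fun _ => c) ∈ polynomialFunctions W :=
  (polynomialFunctions W).algebraMap_mem c

theorem sum_mem_polynomialFunctions {ι : Type*} (s : Finset ι) {f : ι → W → ℂ}
    (hf : ∀ i ∈ s, f i ∈ polynomialFunctions W) :
    (fun w => ∑ i ∈ s, f i w) ∈ polynomialFunctions W := by
  have := sum_mem hf
  rwa [← Finset.sum_fn]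

/-- Polynomial functions pull back along maps whose composites with linear forms are polynomial. -/
theorem comp_mem_polynomialFunctions {P : Type*} [AddCommGroup P] [Module ℂ P] {ψ : P → W}
    (hψ : ∀ φ : Module.Dual ℂ W, (fun p => φ (ψ p)) ∈ polynomialFunctions P)
    {f : W → ℂ} (hf : f ∈ polynomialFunctions W) : (fun p => f (ψ p)) ∈ polynomialFunctions P := by
  induction hf using Algebra.adjoin_induction with
  | mem f hf => obtain ⟨φ, rfl⟩ := hf; exact hψ φ
  | algebraMap c => exact const_mem_polynomialFunctions c
  | add f g _ _ hf hg => exact add_mem hf hg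
  | mul f g _ _ hf hg => exact mul_mem hf hg

/-- The algebra map from polynomials to polynomial functions on a coordinate space. -/
def mvPolynomialToFunctions (ι : Type*) : MvPolynomial ι ℂ →ₐ[ℂ] ((ι → ℂ) → ℂ) :=
  MvPolynomial.aeval fun i x => x i

theorem mvPolynomialToFunctions_apply {ι : Type*} (p : MvPolynomial ι ℂ) (x : ι → ℂ) :
    mvPolynomialToFunctions ι p x = MvPolynomial.eval x p := by
  have : ((Pi.evalAlgHom ℂ (fun _ : ι → ℂ => ℂ) x).comp (mvPolynomialToFunctions ι)) =
      MvPolynomial.aeval x := by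
    ext; simp [mvPolynomialToFunctions]
  exact (DFunLike.congr_fun this p).trans (by rw [MvPolynomial.aeval_eq_eval])

theorem mvPolynomialToFunctions_mem {ι : Type*} (p : MvPolynomial ι ℂ) :
    mvPolynomialToFunctions ι p ∈ polynomialFunctions (ι → ℂ) := by
  have : (mvPolynomialToFunctions ι).range ≤ polynomialFunctions (ι → ℂ) := by
    rw [mvPolynomialToFunctions, ← Algebra.adjoin_range_eq_range_aeval]
    refine Algebra.adjoin_le ?_
    rintro _ ⟨i, rfl⟩
    exact dual_mem_polynomialFunctions (LinearMap.proj i : (ι → ℂ) →ₗ[ℂ] ℂ)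
  exact this ⟨p, rfl⟩

theorem exists_mvPolynomial_of_mem {ι : Type*} [Finite ι] {f : (ι → ℂ) → ℂ}
    (hf : f ∈ polynomialFunctions (ι → ℂ)) : ∃ p, mvPolynomialToFunctions ι p = f := by
  have : polynomialFunctions (ι → ℂ) ≤ (mvPolynomialToFunctions ι).range := by
    refine Algebra.adjoin_le ?_
    rintro _ ⟨φ, rfl⟩
    have := Fintype.ofFinite ι
    classical
    refine ⟨∑ i, MvPolynomial.C (φ (Pi.single i 1)) * MvPolynomial.X i, ?_⟩
    ext x
    change mvPolynomialToFunctions ι _ x = _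
    rw [mvPolynomialToFunctions_apply]
    change _ = φ x
    conv_rhs => rw [← Finset.univ_sum_single x, map_sum]
    simp only [map_sum, map_mul, MvPolynomial.eval_C, MvPolynomial.eval_X]
    refine Finset.sum_congr rfl fun i _ => ?_
    have : Pi.single i (x i) = x i • (Pi.single i 1 : ι → ℂ) := by
      rw [← Pi.single_smul]; simp
    rw [this, map_smul, smul_eq_mul, mul_comm]
  exact this hf

/-- Polynomial functions on a coordinate space have no zero divisors. -/
theorem eq_zero_of_mul_eq_zero {ι : Type*} [Finite ι] {f g : (ι → ℂ) → ℂ}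
    (hf : f ∈ polynomialFunctions (ι → ℂ)) (hg : g ∈ polynomialFunctions (ι → ℂ))
    (h : ∀ x, f x * g x = 0) : f = 0 ∨ g = 0 := by
  obtain ⟨p, rfl⟩ := exists_mvPolynomial_of_mem hf
  obtain ⟨q, rfl⟩ := exists_mvPolynomial_of_mem hg
  have : p * q = 0 := MvPolynomial.funext fun x => by
    simpa [mvPolynomialToFunctions_apply] using h x
  rcases mul_eq_zero.mp this with rfl | rfl <;> simp

theorem isClosed_zariski_iff {Z : Set W} :
    @IsClosed W (zariskiTopology W) Z ↔
      ∃ S : Set (W → ℂ), S ⊆ polynomialFunctions W ∧ Z = zeroLocus S := by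
  let _ := zariskiTopology W
  rw [← isOpen_compl_iff]
  change (Zᶜᶜ ∈ {Z | ∃ S : Set (W → ℂ), S ⊆ polynomialFunctions W ∧ Z = zeroLocus S}) ↔ _
  rw [compl_compl]
  rfl

theorem mem_zariskiClosure_iff {S : Set W} {w : W} :
    w ∈ zariskiClosure S ↔ ∀ f ∈ polynomialFunctions W, (∀ s ∈ S, f s = 0) → f w = 0 := by
  simp only [zariskiClosure, closure, Set.mem_sInter, Set.mem_ofPred_eq, isClosed_zariski_iff]
  constructor
  · intro h f hf hS
    exact h (zeroLocus {f}) ⟨⟨{f}, by simpa using hf, rfl⟩,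
      fun s hs => by simpa [zeroLocus] using hS s hs⟩ f rfl
  · rintro h _ ⟨⟨F, hF, rfl⟩, hS⟩ f hf
    exact h f (hF hf) fun s hs => hS hs f hf

theorem mem_coordinateRing_iff {Z : Set W} {f : Z → ℂ} :
    f ∈ coordinateRing Z ↔ ∃ F ∈ polynomialFunctions W, ∀ z : Z, f z = F z := by
  constructor
  · intro hf
    induction hf using Algebra.adjoin_induction with
    | mem f hf => obtain ⟨φ, rfl⟩ := hf; exact ⟨_, dual_mem_polynomialFunctions φ, fun _ => rfl⟩
    | algebraMap c => exact ⟨_, const_mem_polynomialFunctions c, fun _ => rfl⟩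
    | add f g _ _ hf hg =>
      obtain ⟨F, hF, hF'⟩ := hf
      obtain ⟨G, hG, hG'⟩ := hg
      exact ⟨_, add_mem hF hG, fun z => by simp [hF', hG']⟩
    | mul f g _ _ hf hg =>
      obtain ⟨F, hF, hF'⟩ := hf
      obtain ⟨G, hG, hG'⟩ := hg
      exact ⟨_, mul_mem hF hG, fun z => by simp [hF', hG']⟩
  · rintro ⟨F, hF, hFf⟩
    obtain rfl : f = fun z : Z => F z := funext hFf
    clear hFf
    induction hF using Algebra.adjoin_induction with
    | mem f hf => obtain ⟨φ, rfl⟩ := hf; exact Algebra.subset_adjoin ⟨φ, rfl⟩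
    | algebraMap c => exact (coordinateRing Z).algebraMap_mem c
    | add f g _ _ hf hg => exact add_mem hf hg
    | mul f g _ _ hf hg => exact mul_mem hf hg

theorem finiteType_coordinateRing [FiniteDimensional ℂ W] (Z : Set W) :
    Algebra.FiniteType ℂ (coordinateRing Z) := by
  let b := Module.finBasis ℂ (Module.Dual ℂ W)
  let s : Set (Z → ℂ) := Set.range fun i (z : Z) => b i z
  have hs : coordinateRing Z = Algebra.adjoin ℂ s := by
    refine le_antisymm (Algebra.adjoin_le ?_) (Algebra.adjoin_mono ?_)
    · rintro _ ⟨φ, rfl⟩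
      have : (fun z : Z => φ z) = ∑ i, b.repr φ i • fun z : Z => b i z := by
        ext z
        conv_lhs => rw [← b.sum_repr φ, LinearMap.sum_apply]
        simp
      change (fun z : Z => φ z) ∈ _
      rw [this]
      exact sum_mem fun i _ => Subalgebra.smul_mem _ (Algebra.subset_adjoin (Set.mem_range_self i)) _
    · rintro _ ⟨i, rfl⟩
      exact ⟨b i, rfl⟩
  rw [hs]
  have hfg : (Algebra.adjoin ℂ s).FG := by
    rw [← (Set.finite_range _).coe_toFinset (s := s)]
    exact Subalgebra.fg_adjoin_finset _
  exact (Subalgebra.fg_iff_finiteType _).mp hfg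

end PolynomialFunctions

/-! ### The symmetric trilinear form of a tensor and its coordinates -/

section Multiplication

variable {V : Type*} [AddCommGroup V] [Module ℂ V] {B : LinearMap.BilinForm ℂ V}

/-- The product `μ_T(x, y)` as a linear function of `T`. -/
noncomputable def muLeft (B : LinearMap.BilinForm ℂ V) (x y : V) : symCube V →ₗ[ℂ] V where
  toFun T := mu B T x y
  map_add' S T := mu_add_left B S T x y
  map_smul' c T := mu_smul_left B c T x y

@[simp] theorem muLeft_apply (x y : V) (T : symCube V) : muLeft B x y T = mu B T x y := rfl

/-- The bilinear map `μ_T`. -/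
noncomputable def muBilin (B : LinearMap.BilinForm ℂ V) (T : symCube V) : V →ₗ[ℂ] V →ₗ[ℂ] V :=
  LinearMap.mk₂ ℂ (mu B T) (mu_add_fst B T) (fun c => mu_smul_fst B c T) (mu_add_snd B T)
    (fun c => mu_smul_snd B c T)

@[simp] theorem muBilin_apply (T : symCube V) (x y : V) : muBilin B T x y = mu B T x y := rfl

theorem contract_contract_leftComm (x y : V) (T : V ⊗[ℂ] (V ⊗[ℂ] V)) :
    contract B V y (contract B (V ⊗[ℂ] V) x (TensorProduct.leftComm ℂ V V V T)) =
      contract B V x (contract B (V ⊗[ℂ] V) y T) := by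
  induction T with
  | zero => simp
  | add S T hS hT => simp only [map_add, hS, hT]
  | tmul u m =>
    induction m with
    | zero => simp
    | add S T hS hT => simp only [TensorProduct.tmul_add, map_add, hS, hT]
    | tmul v w => simp [contract_tmul, smul_smul, mul_comm]

theorem contract_contract_lTensor_comm (x y z : V) (T : V ⊗[ℂ] (V ⊗[ℂ] V)) :
    B (contract B V y (contract B (V ⊗[ℂ] V) x
      (LinearMap.lTensor V (TensorProduct.comm ℂ V V).toLinearMap T))) z =
      B (contract B V z (contract B (V ⊗[ℂ] V) x T)) y := by
  induction T with
  | zero => simp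
  | add S T hS hT => simp only [map_add, LinearMap.add_apply, hS, hT]
  | tmul u m =>
    induction m with
    | zero => simp
    | add S T hS hT =>
      simp only [TensorProduct.tmul_add, map_add, LinearMap.add_apply, hS, hT]
    | tmul v w => simp [contract_tmul, mul_comm]

theorem mu_comm (T : symCube V) (x y : V) : mu B T x y = mu B T y x := by
  have := contract_contract_leftComm (B := B) x y T.1
  rwa [T.2.1] at this

/-- Invariance under the transposition of the last two factors. With `mu_comm` it makes
`(μ_T(x,y)|z)` symmetric in all three arguments. -/
theorem form_mu_right_comm (T : symCube V) (x y z : V) :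
    B (mu B T x y) z = B (mu B T x z) y := by
  have := contract_contract_lTensor_comm (B := B) x y z T.1
  rwa [T.2.2] at this

theorem mu_sum_smul_cube {ι : Type*} (s : Finset ι) (c : ι → ℂ) (v : ι → V) (x y : V) :
    mu B (∑ i ∈ s, c i • cube (v i)) x y = ∑ i ∈ s, (c i * (B (v i) x * B (v i) y)) • v i := by
  rw [← muLeft_apply, map_sum]
  simp [mu_cube, smul_smul]

theorem cube_smul (c : ℂ) (v : V) : cube (c • v) = c ^ 3 • cube v := by
  ext
  simp only [cube, Submodule.coe_smul, ← TensorProduct.smul_tmul', TensorProduct.tmul_smul, smul_smul]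
  ring_nf

/-! ### Coordinates with respect to an orthonormal basis -/

variable {ι : Type*} [Fintype ι] [DecidableEq ι] {e : Module.Basis ι ℂ V}

theorem repr_eq_form (he : ∀ i j, B (e i) (e j) = if i = j then 1 else 0) (v : V) (i : ι) :
    e.repr v i = B v (e i) := by
  conv_rhs => rw [← e.sum_repr v, map_sum, LinearMap.sum_apply]
  simp [he]

theorem repr_tensor_eq_form (he : ∀ i j, B (e i) (e j) = if i = j then 1 else 0)
    (T : V ⊗[ℂ] (V ⊗[ℂ] V)) (i j k : ι) :
    (e.tensorProduct (e.tensorProduct e)).repr T (i, j, k) =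
      B (contract B V (e j) (contract B (V ⊗[ℂ] V) (e i) T)) (e k) := by
  induction T with
  | zero => simp
  | add S T hS hT => simp only [map_add, LinearMap.add_apply, Finsupp.add_apply, hS, hT]
  | tmul u m =>
    induction m with
    | zero => simp
    | add S T hS hT =>
      simp only [TensorProduct.tmul_add, map_add, LinearMap.add_apply, Finsupp.add_apply, hS, hT]
    | tmul v w => simp [contract_tmul, repr_eq_form he]; ring

theorem ext_of_form_mu (he : ∀ i j, B (e i) (e j) = if i = j then 1 else 0) {S T : symCube V}
    (h : ∀ i j k, B (mu B S (e i) (e j)) (e k) = B (mu B T (e i) (e j)) (e k)) : S = T := by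
  refine Subtype.ext ((e.tensorProduct (e.tensorProduct e)).ext_elem ?_)
  rintro ⟨i, j, k⟩
  rw [repr_tensor_eq_form he, repr_tensor_eq_form he]
  exact h i j k

/-- The symmetric tensor with prescribed symmetric coordinates. -/
noncomputable def ofCoords (e : Module.Basis ι ℂ V) (d : ι → ι → ι → ℂ)
    (h₁ : ∀ i j k, d i j k = d j i k) (h₂ : ∀ i j k, d i j k = d i k j) : symCube V :=
  ⟨∑ i, ∑ j, ∑ k, d i j k • (e i ⊗ₜ[ℂ] (e j ⊗ₜ[ℂ] e k)), by
    constructor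
    · simp only [map_sum, map_smul, TensorProduct.leftComm_tmul]
      rw [Finset.sum_comm]
      simp only [h₁]
    · simp only [map_sum, map_smul, LinearMap.lTensor_tmul, LinearEquiv.coe_coe,
        TensorProduct.comm_tmul]
      refine Finset.sum_congr rfl fun i _ => ?_
      rw [Finset.sum_comm]
      simp only [h₂]⟩

theorem form_mu_ofCoords (he : ∀ i j, B (e i) (e j) = if i = j then 1 else 0)
    (d : ι → ι → ι → ℂ) (h₁ : ∀ i j k, d i j k = d j i k)
    (h₂ : ∀ i j k, d i j k = d i k j) (i j k : ι) :
    B (mu B (ofCoords e d h₁ h₂) (e i) (e j)) (e k) = d i j k := by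
  simp [mu, ofCoords, contract_tmul, he]

end Multiplication

/-! ### The tangent space at the sum of cubes of an orthonormal basis -/

section TangentSpace

variable {V : Type*} [AddCommGroup V] [Module ℂ V] {B : LinearMap.BilinForm ℂ V}

/-- The expression is trilinear; the arguments are freed from the basis one at a time, beginning
with the last. -/
theorem robevaDiff_eq_zero_of_basis {ι : Type*} (e : Module.Basis ι ℂ V) {T D : symCube V}
    (h : ∀ i j k, robevaDiff B T D (e i) (e j) (e k) = 0) (x y z : V) :
    robevaDiff B T D x y z = 0 := by
  have h₁ (i j : ι) (z : V) : robevaDiff B T D (e i) (e j) z = 0 := by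
    have : muBilin B D (e i) ∘ₗ muBilin B T (e j) + muBilin B T (e i) ∘ₗ muBilin B D (e j) -
        (muBilin B D (mu B T (e i) (e j)) + muBilin B T (mu B D (e i) (e j))) = 0 :=
      e.ext fun k => h i j k
    exact LinearMap.congr_fun this z
  have h₂ (i : ι) (y z : V) : robevaDiff B T D (e i) y z = 0 := by
    have : muBilin B D (e i) ∘ₗ (muBilin B T).flip z + muBilin B T (e i) ∘ₗ (muBilin B D).flip z -
        ((muBilin B D).flip z ∘ₗ muBilin B T (e i) +
          (muBilin B T).flip z ∘ₗ muBilin B D (e i)) = 0 :=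
      e.ext fun j => h₁ i j z
    exact LinearMap.congr_fun this y
  have : (muBilin B D).flip (mu B T y z) + (muBilin B T).flip (mu B D y z) -
      ((muBilin B D).flip z ∘ₗ (muBilin B T).flip y +
        (muBilin B T).flip z ∘ₗ (muBilin B D).flip y) = 0 :=
    e.ext fun i => h₂ i y z
  exact LinearMap.congr_fun this x

/-- Pairs `i ≤ j` of indices. -/
abbrev OrderedPair (n : ℕ) : Type := {p : Fin n × Fin n // p.1 ≤ p.2}

theorem card_orderedPair (n : ℕ) : Fintype.card (OrderedPair n) = (n + 1).choose 2 := by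
  rw [Fintype.card_subtype, ← Finset.univ_product_univ, Finset.card_filter, Finset.sum_product]
  simp only [← Finset.card_filter]
  have (i : Fin n) : (Finset.univ.filter fun j => i ≤ j).card = n - i := by
    rw [← Fin.card_Ici]; congr 1; ext; simp
  simp only [this]
  rw [Fin.sum_univ_eq_sum_range (fun i => n - i) n, Nat.choose_two_right,
    ← Finset.sum_range_id_mul_two,
    Nat.mul_div_cancel _ two_pos, Finset.sum_range_succ', ← Finset.sum_range_reflect]
  refine Finset.sum_congr rfl fun i hi => ?_
  have := Finset.mem_range.mp hi
  omega

variable {n : ℕ} {e : Module.Basis (Fin n) ℂ V}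

theorem mu_sum_cube_basis (he : ∀ i j, B (e i) (e j) = if i = j then 1 else 0) (i j : Fin n) :
    mu B (∑ i, cube (e i)) (e i) (e j) = if i = j then e i else 0 := by
  have := mu_sum_smul_cube (B := B) Finset.univ (fun _ => 1) e (e i) (e j)
  simp only [one_smul, one_mul] at this
  rw [this]
  rcases eq_or_ne i j with rfl | h
  · simp [he]
  · simp [he, h, h.symm]

theorem form_mu_sum_cube (he : ∀ i j, B (e i) (e j) = if i = j then 1 else 0) (x y : V)
    (l : Fin n) :
    B (mu B (∑ i, cube (e i)) x y) (e l) = B (e l) x * B (e l) y := by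
  have := mu_sum_smul_cube (B := B) Finset.univ (fun _ => 1) e x y
  simp only [one_smul, one_mul] at this
  rw [this]
  simp [he]

/-- For `μ_E` the `e i` are orthogonal idempotents, so each term of the linearized associator,
paired with a basis vector, is a Kronecker delta times a coordinate of `D`. -/
theorem mem_tangentSpaceX_iff (hsymm : B.IsSymm)
    (he : ∀ i j, B (e i) (e j) = if i = j then 1 else 0) {D : symCube V} :
    D ∈ tangentSpaceX B (∑ i, cube (e i)) ↔ ∀ i j k l,
      (if j = k then B (mu B D (e i) (e j)) (e l) else 0)
        + (if i = l then B (mu B D (e j) (e k)) (e i) else 0)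
        - ((if i = j then B (mu B D (e i) (e k)) (e l) else 0)
        + (if k = l then B (mu B D (e i) (e j)) (e k) else 0)) = 0 := by
  have key (i j k l : Fin n) : B (robevaDiff B (∑ i, cube (e i)) D (e i) (e j) (e k)) (e l) =
      (if j = k then B (mu B D (e i) (e j)) (e l) else 0)
        + (if i = l then B (mu B D (e j) (e k)) (e i) else 0)
        - ((if i = j then B (mu B D (e i) (e k)) (e l) else 0)
        + (if k = l then B (mu B D (e i) (e j)) (e k) else 0)) := by
    have hs (v : V) : B (e l) v = B v (e l) := hsymm.eq _ _
    have hz (v : V) : mu B D v 0 = 0 ∧ mu B D 0 v = 0 :=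
      ⟨map_zero (muBilin B D v), LinearMap.congr_fun (map_zero (muBilin B D)) v⟩
    simp only [robevaDiff, map_sub, map_add, LinearMap.sub_apply, LinearMap.add_apply,
      form_mu_sum_cube he, mu_sum_cube_basis he]
    congr 1
    · congr 1
      · split_ifs <;> simp [hz]
      · rw [he, hs]
        rcases eq_or_ne i l with rfl | h
        · simp
        · simp [h, h.symm]
    · congr 1
      · split_ifs <;> simp [hz]
      · rw [he, hs]
        rcases eq_or_ne k l with rfl | h
        · simp
        · simp [h, h.symm]
  constructor
  · intro h i j k l
    rw [← key, h (e i) (e j) (e k)]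
    simp
  · intro h
    refine robevaDiff_eq_zero_of_basis e fun i j k => e.ext_elem fun l => ?_
    rw [repr_eq_form he, key, h]
    simp

/-- The coordinates of the tensor with `D_iij = a i j` and vanishing coordinates at triples of
distinct indices. -/
def pairCoords {ι : Type*} [DecidableEq ι] (a : ι → ι → ℂ) (i j k : ι) : ℂ :=
  if i = j then a i k else if j = k then a j i else if i = k then a i j else 0

theorem pairCoords_left_comm {ι : Type*} [DecidableEq ι] (a : ι → ι → ℂ) (i j k : ι) :
    pairCoords a i j k = pairCoords a j i k := by
  unfold pairCoords; grind

theorem pairCoords_right_comm {ι : Type*} [DecidableEq ι] (a : ι → ι → ℂ) (i j k : ι) :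
    pairCoords a i j k = pairCoords a i k j := by
  unfold pairCoords; grind

/-- The equations amount to `D_ijk = 0` for distinct indices and `D_iij = -D_jji` for `i ≠ j`. The
values `D_iij` with `i ≤ j` are then free and determine `D`. -/
theorem finrank_tangentSpaceX (hsymm : B.IsSymm)
    (he : ∀ i j, B (e i) (e j) = if i = j then 1 else 0) :
    Module.finrank ℂ (tangentSpaceX B (∑ i, cube (e i))) = (n + 1).choose 2 := by
  let F : tangentSpaceX B (∑ i, cube (e i)) →ₗ[ℂ] (OrderedPair n → ℂ) :=
    { toFun := fun D p => B (mu B D (e p.1.1) (e p.1.1)) (e p.1.2)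
      map_add' := fun D D' => by ext p; simp [mu_add_left]
      map_smul' := fun c D => by ext p; simp [mu_smul_left] }
  have hinj : Function.Injective F := by
    rw [injective_iff_map_eq_zero]
    intro D hD
    have hD' (i j : Fin n) (hij : i ≤ j) : B (mu B D (e i) (e i)) (e j) = 0 :=
      congr_fun hD ⟨(i, j), hij⟩
    have hmem := (mem_tangentSpaceX_iff hsymm he).mp D.2
    have hc := fun i j => mu_comm (B := B) D.1 (e i) (e j)
    have hr := fun i j k => form_mu_right_comm (B := B) D.1 (e i) (e j) (e k)
    have hiij (i j : Fin n) : B (mu B D (e i) (e i)) (e j) = 0 := by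
      rcases le_or_gt i j with hij | hij
      · exact hD' i j hij
      · have h1 := hD' j i hij.le
        have h2 := hmem i j j i
        simp [hij.ne, hij.ne'] at h2
        rw [hr, h1] at h2
        simpa using h2
    refine Subtype.ext (ext_of_form_mu he fun i j k => ?_)
    have h0 : B (mu B (0 : symCube V) (e i) (e j)) (e k) = 0 := by
      rw [← muLeft_apply, map_zero]; simp
    refine Eq.trans ?_ h0.symm
    by_cases hij : i = j
    · subst hij; exact hiij i k
    by_cases hjk : j = k
    · subst hjk; rw [hc, hr]; exact hiij _ _
    by_cases hik : i = k
    · subst hik; rw [hr]; exact hiij _ _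
    have := hmem i j k k
    simpa [hij, hjk, hik] using this
  have hsurj : Function.Surjective F := by
    intro f
    -- The given values, extended antisymmetrically off the diagonal as `D_iij = -D_jji` demands.
    let a (i j : Fin n) : ℂ := if h : i ≤ j then f ⟨(i, j), h⟩ else - f ⟨(j, i), (not_le.mp h).le⟩
    have ha (i j : Fin n) (hij : i ≠ j) : a i j = - a j i := by
      rcases lt_or_gt_of_ne hij with h | h
      · simp [a, h.le, not_le.mpr h]
      · simp [a, h.le, not_le.mpr h]
    refine ⟨⟨ofCoords e (pairCoords a) (pairCoords_left_comm a) (pairCoords_right_comm a), ?_⟩, ?_⟩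
    · rw [mem_tangentSpaceX_iff hsymm he]
      intro i j k l
      simp only [form_mu_ofCoords he]
      simp only [pairCoords]
      clear_value a
      grind
    · ext p
      change B (mu B (ofCoords e _ (pairCoords_left_comm a) (pairCoords_right_comm a)) _ _) _ = _
      rw [form_mu_ofCoords he]
      simp [pairCoords, a, p.2]
  rw [(LinearEquiv.ofBijective F ⟨hinj, hsurj⟩).finrank_eq, Module.finrank_fintype_fun_eq_card,
    card_orderedPair]

end TangentSpace

/-! ### Strongly odeco tensors in orthonormal form; Robeva's equations -/

section StronglyOdeco

variable {V : Type*} [AddCommGroup V] [Module ℂ V] {B : LinearMap.BilinForm ℂ V}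

/-- Cube roots absorb the coefficients into the vectors; terms with coefficient zero are dropped,
since their vectors would become isotropic. -/
theorem isStronglyOdeco_sum_smul_cube {ι : Type*} [Fintype ι] (c : ι → ℂ) {v : ι → V}
    (hv : ∀ i, B (v i) (v i) ≠ 0) (ho : ∀ i j, i ≠ j → B (v i) (v j) = 0) :
    IsStronglyOdeco B (∑ i, c i • cube (v i)) := by
  classical
  choose r hr using fun i => IsAlgClosed.exists_pow_nat_eq (c i) (n := 3) (by norm_num)
  let σ := (Fintype.equivFin {i // c i ≠ 0}).symm
  refine ⟨_, fun j => r (σ j) • v (σ j), fun j => ?_, fun i j hij => ?_, ?_⟩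
  · have : r (σ j) ≠ 0 := fun h => (σ j).2 (by rw [← hr, h]; norm_num)
    simp [this, hv]
  · have : (σ i : ι) ≠ σ j := fun h => hij (σ.injective (Subtype.ext h))
    simp [ho _ _ this]
  · simp only [cube_smul, hr]
    rw [σ.sum_comp (fun i => c i • cube (v i)),
      ← Finset.sum_subtype (Finset.univ.filter fun i => c i ≠ 0) (by simp) fun i => c i • cube (v i),
      Finset.sum_filter]
    refine Finset.sum_congr rfl fun i _ => ?_
    split_ifs with h <;> simp_all

theorem IsStronglyOdeco.exists_orthonormal {T : symCube V} (hT : IsStronglyOdeco B T) :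
    ∃ (k : ℕ) (u : Fin k → V) (c : Fin k → ℂ), (∀ i j, B (u i) (u j) = if i = j then 1 else 0) ∧
      T = ∑ i, c i • cube (u i) := by
  obtain ⟨k, v, hv, ho, rfl⟩ := hT
  choose r hr using fun i => IsAlgClosed.exists_pow_nat_eq (B (v i) (v i)) (n := 2) (by norm_num)
  have hr0 (i) : r i ≠ 0 := fun h => hv i (by rw [← hr, h]; norm_num)
  refine ⟨k, fun i => (r i)⁻¹ • v i, fun i => r i ^ 3, fun i j => ?_, ?_⟩
  · split_ifs with h
    · subst h
      have := hr0 i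
      simp [← hr]
      field_simp
    · simp [ho i j h]
  · refine Finset.sum_congr rfl fun i _ => ?_
    rw [cube_smul, smul_smul, ← mul_pow, mul_inv_cancel₀ (hr0 i), one_pow, one_smul]

/-- If every vector orthogonal to the `u i` were isotropic, polarization would make the form vanish
on their orthogonal complement. Nondegeneracy would then make that complement zero and the fewer
than `dim V` vectors `u i` spanning. -/
theorem exists_unit_orthogonal [FiniteDimensional ℂ V] (hsymm : B.IsSymm) (hnondeg : B.Nondegenerate)
    {k : ℕ} (hk : k < Module.finrank ℂ V) {u : Fin k → V}
    (hu : ∀ i j, B (u i) (u j) = if i = j then 1 else 0) :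
    ∃ x, B x x = 1 ∧ ∀ i, B (u i) x = 0 := by
  have hs (x y : V) : B x y = B y x := hsymm.eq x y
  suffices ∃ x, B x x ≠ 0 ∧ ∀ i, B (u i) x = 0 by
    obtain ⟨x, hx, hux⟩ := this
    obtain ⟨r, hr⟩ := IsAlgClosed.exists_pow_nat_eq (B x x) (n := 2) (by norm_num)
    have hr0 : r ≠ 0 := fun h => hx (by rw [← hr, h]; norm_num)
    refine ⟨r⁻¹ • x, ?_, fun i => by simp [hux]⟩
    simp [← hr]
    field_simp
  by_contra! hcon
  have hcon' : ∀ x, (∀ i, B (u i) x = 0) → B x x = 0 := by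
    intro x hx
    by_contra h
    obtain ⟨i, hi⟩ := hcon x h
    exact hi (hx i)
  have hpol (x y : V) (hx : ∀ i, B (u i) x = 0) (hy : ∀ i, B (u i) y = 0) : B x y = 0 := by
    have h := hcon' (x + y) fun i => by simp [hx, hy]
    simp only [map_add, LinearMap.add_apply, hcon' x hx, hcon' y hy, hs y x] at h
    linear_combination h / 2
  have hzero (x : V) (hx : ∀ i, B (u i) x = 0) : x = 0 := by
    refine hnondeg.1 x fun w => ?_
    have h := hpol x (w - ∑ i, B (u i) w • u i) hx fun i => by simp [hu]
    simpa [hs x (u _), hx] using h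
  have hspan : ⊤ ≤ Submodule.span ℂ (Set.range u) := by
    intro w _
    have := hzero (w - ∑ i, B (u i) w • u i) fun i => by simp [hu]
    rw [sub_eq_zero.mp this]
    exact sum_mem fun i _ => Submodule.smul_mem _ _ (Submodule.subset_span ⟨i, rfl⟩)
  have := finrank_range_le_card (R := ℂ) u
  rw [Set.finrank, top_le_iff.mp hspan, finrank_top, Fintype.card_fin] at this
  omega

theorem linearIndependent_of_orthonormal {ι : Type*} [DecidableEq ι] {u : ι → V}
    (hu : ∀ i j, B (u i) (u j) = if i = j then 1 else 0) : LinearIndependent ℂ u := by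
  rw [linearIndependent_iff']
  intro s g h i hi
  have := congrArg (fun v => B v (u i)) h
  simpa [hu, hi] using this

/-- New unit vectors are adjoined with coefficient zero, so the tensor is unchanged. -/
theorem exists_orthonormal_extension [FiniteDimensional ℂ V] (hsymm : B.IsSymm)
    (hnondeg : B.Nondegenerate) {k : ℕ} (u : Fin k → V) (c : Fin k → ℂ)
    (hu : ∀ i j, B (u i) (u j) = if i = j then 1 else 0) :
    ∃ (w : Fin (Module.finrank ℂ V) → V) (d : Fin (Module.finrank ℂ V) → ℂ),
      (∀ i j, B (w i) (w j) = if i = j then 1 else 0) ∧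
      ∑ i, c i • cube (u i) = ∑ i, d i • cube (w i) := by
  have hk : k ≤ Module.finrank ℂ V := by
    simpa using (linearIndependent_of_orthonormal hu).fintype_card_le_finrank
  induction hm : Module.finrank ℂ V - k generalizing k with
  | zero =>
    obtain rfl : k = Module.finrank ℂ V := by omega
    exact ⟨u, c, hu, rfl⟩
  | succ m ih =>
    obtain ⟨x, hx, hux⟩ := exists_unit_orthogonal hsymm hnondeg (by omega) hu
    obtain ⟨w, d, hw, hd⟩ := ih (Fin.snoc u x : Fin (k + 1) → V) (Fin.snoc c 0 : Fin (k + 1) → ℂ)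
      (fun i j => by
        have hxu (i) : B x (u i) = 0 := (hsymm.eq _ _).trans (hux i)
        induction i using Fin.lastCases <;> induction j using Fin.lastCases <;>
          simp [hu, hux, hx, hxu, Fin.castSucc_ne_last, (Fin.castSucc_ne_last _).symm])
      (by omega) (by omega)
    exact ⟨w, d, hw, by rw [← hd, Fin.sum_univ_castSucc]; simp⟩

theorem exists_orthonormalBasis [FiniteDimensional ℂ V] (hsymm : B.IsSymm)
    (hnondeg : B.Nondegenerate) : ∃ e : Module.Basis (Fin (Module.finrank ℂ V)) ℂ V,
      ∀ i j, B (e i) (e j) = if i = j then 1 else 0 := by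
  obtain ⟨w, -, hw, -⟩ := exists_orthonormal_extension hsymm hnondeg (Fin.elim0) (Fin.elim0)
    fun i => i.elim0
  exact ⟨basisOfLinearIndependentOfCardEqFinrank' w (linearIndependent_of_orthonormal hw) (by simp),
    by simpa using hw⟩

theorem IsStronglyOdeco.mem_X {T : symCube V} (hT : IsStronglyOdeco B T) :
    T ∈ X B := by
  obtain ⟨k, u, c, hu, rfl⟩ := hT.exists_orthonormal
  intro x y z
  simp only [mu_sum_smul_cube, map_sum, map_smul, hu]
  refine Finset.sum_congr rfl fun i _ => ?_
  congr 1
  simp only [smul_eq_mul, mul_ite, mul_one, mul_zero, Finset.sum_ite_eq, Finset.mem_univ, if_true]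
  ring

/-- After expansion of the inner product in a basis, each coordinate of the associator is a
quadratic polynomial in `T`. -/
theorem isClosed_X [FiniteDimensional ℂ V] :
    @IsClosed (symCube V) (zariskiTopology (symCube V)) (X B) := by
  rw [isClosed_zariski_iff]
  let b := Module.finBasis ℂ V
  refine ⟨{f | ∃ i x y z, f = fun T => b.coord i (robeva B T x y z)}, ?_, ?_⟩
  · rintro _ ⟨i, x, y, z, rfl⟩
    have h₁ (T : symCube V) : b.coord i (robeva B T x y z) =
        ∑ j, (b.coord j ∘ₗ muLeft B y z) T * (b.coord i ∘ₗ muLeft B x (b j)) T -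
        ∑ j, (b.coord j ∘ₗ muLeft B x y) T * (b.coord i ∘ₗ muLeft B (b j) z) T := by
      have hx : mu B T x (mu B T y z) = ∑ j, b.coord j (mu B T y z) • mu B T x (b j) := by
        conv_lhs => rw [← b.sum_repr (mu B T y z), ← muBilin_apply, map_sum]
        simp
      have hz : mu B T (mu B T x y) z = ∑ j, b.coord j (mu B T x y) • mu B T (b j) z := by
        conv_lhs => rw [← b.sum_repr (mu B T x y), ← muBilin_apply, map_sum, LinearMap.sum_apply]
        simp
      rw [robeva, hx, hz]
      simp
    simp only [h₁]
    exact sub_mem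
      (sum_mem_polynomialFunctions _ fun j _ => mul_mem (dual_mem_polynomialFunctions _)
        (dual_mem_polynomialFunctions _))
      (sum_mem_polynomialFunctions _ fun j _ => mul_mem (dual_mem_polynomialFunctions _)
        (dual_mem_polynomialFunctions _))
  · ext T
    constructor
    · rintro h _ ⟨i, x, y, z, rfl⟩
      change b.coord i (robeva B T x y z) = 0
      rw [robeva, h, sub_self, map_zero]
    · intro h x y z
      rw [← sub_eq_zero]
      exact b.ext_elem fun i => by
        rw [map_zero]
        exact h _ ⟨i, x, y, z, rfl⟩

end StronglyOdeco

/-! ### Tensors in `X` with a multiplication operator of distinct eigenvalues -/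

section DistinctEigenvalues

/-- The determinant of `p'(L)`, with `p` the characteristic polynomial of `L`; up to sign it is the
discriminant of `p`. -/
noncomputable def charpolyDisc {V : Type*} [AddCommGroup V] [Module ℂ V] [FiniteDimensional ℂ V]
    (L : Module.End ℂ V) : ℂ :=
  LinearMap.det (Polynomial.aeval L (Polynomial.derivative L.charpoly))

variable {V : Type*} [AddCommGroup V] [Module ℂ V] [FiniteDimensional ℂ V]

/-- At a multiple root `a` of the characteristic polynomial `p` one has `p'(a) = 0`, so an
eigenvector for `a` lies in the kernel of `p'(L)`. -/
theorem exists_eigenvectors_of_charpolyDisc_ne_zero {L : Module.End ℂ V}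
    (h : charpolyDisc L ≠ 0) :
    ∃ (μ : Fin (Module.finrank ℂ V) → ℂ) (v : Fin (Module.finrank ℂ V) → V),
      Function.Injective μ ∧ ∀ i, L.HasEigenvector (μ i) (v i) := by
  have hp : L.charpoly ≠ 0 := L.charpoly_monic.ne_zero
  have hnodup : L.charpoly.roots.Nodup := by
    rw [Multiset.nodup_iff_count_le_one]
    intro a
    by_contra! ha
    rw [Polynomial.count_roots, Polynomial.one_lt_rootMultiplicity_iff_isRoot hp] at ha
    obtain ⟨v, hv⟩ :=
      ((Module.End.hasEigenvalue_iff_isRoot_charpoly L a).mpr ha.1).exists_hasEigenvector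
    have hinj := (LinearMap.equivOfDetNeZero _ h).injective
    refine hv.2 (hinj ?_)
    rw [map_zero]
    change Polynomial.aeval L _ v = 0
    rw [Module.End.aeval_apply_of_hasEigenvector hv, ha.2, zero_smul]
  have hcard : L.charpoly.roots.toFinset.card = Module.finrank ℂ V := by
    rw [Multiset.toFinset_card_of_nodup hnodup, IsAlgClosed.card_roots_eq_natDegree,
      LinearMap.charpoly_natDegree]
  let σ := (Finset.equivFinOfCardEq hcard).symm
  have hroot (i) : L.charpoly.IsRoot (σ i) := by
    have := (σ i).2
    rw [Multiset.mem_toFinset, Polynomial.mem_roots hp] at this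
    exact this
  choose v hv using fun i =>
    ((Module.End.hasEigenvalue_iff_isRoot_charpoly L (σ i)).mpr (hroot i)).exists_hasEigenvector
  exact ⟨fun i => σ i, v, Subtype.val_injective.comp σ.injective, hv⟩

theorem charpolyDisc_ne_zero_of_basis {ι : Type*} [Fintype ι] [DecidableEq ι]
    (b : Module.Basis ι ℂ V) {d : ι → ℂ} (hd : Function.Injective d) {L : Module.End ℂ V}
    (hL : ∀ i, L (b i) = d i • b i) : charpolyDisc L ≠ 0 := by
  have hdiag (f : Module.End ℂ V) (c : ι → ℂ) (hf : ∀ i, f (b i) = c i • b i) :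
      LinearMap.toMatrix b b f = Matrix.diagonal c := by
    ext i j
    rw [LinearMap.toMatrix_apply, hf]
    rcases eq_or_ne i j with rfl | h
    · simp
    · simp [h]
  have hp : L.charpoly = ∏ i, (Polynomial.X - Polynomial.C (d i)) := by
    rw [← LinearMap.charpoly_toMatrix L b, hdiag L d hL, Matrix.charpoly_diagonal]
  have hsep : L.charpoly.Separable := by
    rw [hp]; exact Polynomial.separable_prod_X_sub_C_iff.mpr hd
  rw [charpolyDisc, ← LinearMap.det_toMatrix b,
    hdiag _ (fun i => (Polynomial.derivative L.charpoly).eval (d i)), Matrix.det_diagonal,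
    Finset.prod_ne_zero_iff]
  · intro i _
    refine hsep.eval₂_derivative_ne_zero (RingHom.id ℂ) ?_
    rw [Polynomial.eval₂_id, hp, Polynomial.eval_prod]
    exact Finset.prod_eq_zero (Finset.mem_univ i) (by simp)
  · intro i
    exact Module.End.aeval_apply_of_hasEigenvector
      ⟨Module.End.mem_eigenspace_iff.mpr (hL i), b.ne_zero i⟩

variable {B : LinearMap.BilinForm ℂ V}

/-- The same determinant is formed for the generic matrix over the ring of polynomial functions;
evaluation at `T` is a ring homomorphism and commutes with the construction. -/
theorem charpolyDisc_mem_polynomialFunctions (x : V) :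
    (fun T : symCube V => charpolyDisc (muBilin B T x)) ∈ polynomialFunctions (symCube V) := by
  let b := Module.finBasis ℂ V
  let M : Matrix (Fin (Module.finrank ℂ V)) (Fin (Module.finrank ℂ V))
      (polynomialFunctions (symCube V)) :=
    fun i j => ⟨_, dual_mem_polynomialFunctions (b.coord i ∘ₗ muLeft B x (b j))⟩
  let q := (Polynomial.aeval M (Polynomial.derivative M.charpoly)).det
  suffices (fun T : symCube V => charpolyDisc (muBilin B T x)) = q by
    rw [this]; exact q.2
  ext T
  let ev : polynomialFunctions (symCube V) →+* ℂ :=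
    (Pi.evalRingHom (fun _ : symCube V => ℂ) T).comp (polynomialFunctions (symCube V)).val.toRingHom
  have hM : ev.mapMatrix M = LinearMap.toMatrixAlgEquiv b (muBilin B T x) := by
    ext i j
    rw [LinearMap.toMatrixAlgEquiv_apply]
    rfl
  change _ = ev q
  have hcomp : (algebraMap ℂ (Matrix (Fin (Module.finrank ℂ V)) (Fin (Module.finrank ℂ V)) ℂ)).comp
      ev = ev.mapMatrix.comp (algebraMap (polynomialFunctions (symCube V)) _) := by
    ext r i j
    simp only [RingHom.comp_apply, Matrix.algebraMap_matrix_apply, RingHom.mapMatrix_apply,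
      Matrix.map_apply]
    split_ifs <;> simp
  have haeval := Polynomial.map_aeval_eq_aeval_map hcomp (Polynomial.derivative M.charpoly) M
  rw [RingHom.map_det, haeval, ← Polynomial.derivative_map, ← Matrix.charpoly_map,
    ← RingHom.mapMatrix_apply, hM, charpolyDisc, ← LinearMap.det_toMatrix b,
    ← LinearMap.charpoly_toMatrix _ b]
  congr 1
  exact (Polynomial.aeval_algHom_apply (LinearMap.toMatrixAlgEquiv b).toAlgHom _ _).symm

/-- Symmetry of the trilinear form makes `L = μ_T(x,·)` self-adjoint, so eigenvectors for different
eigenvalues are orthogonal and can be normalized to a basis `e`. By associativity `L(e_i e_j) = (L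
e_i) e_j = μ_i e_i e_j`, so `e_i e_j` is a multiple of `e_i`; by symmetry only the coordinates
`T_iii` survive. -/
theorem isStronglyOdeco_of_charpolyDisc_ne_zero (hsymm : B.IsSymm) (hnondeg : B.Nondegenerate)
    {T : symCube V} (hT : T ∈ X B) {x : V} (hx : charpolyDisc (muBilin B T x) ≠ 0) :
    IsStronglyOdeco B T := by
  have hs (x y : V) : B x y = B y x := hsymm.eq x y
  obtain ⟨μ, v, hμ, hv⟩ := exists_eigenvectors_of_charpolyDisc_ne_zero hx
  have hLv (i) : mu B T x (v i) = μ i • v i := (hv i).apply_eq_smul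
  have hadj (y z : V) : B (mu B T x y) z = B y (mu B T x z) := by
    rw [form_mu_right_comm, hs]
  have horth (c d : ℂ) (hcd : c ≠ d) (y z : V) (hy : mu B T x y = c • y)
      (hz : mu B T x z = d • z) : B y z = 0 := by
    have := hadj y z
    rw [hy, hz] at this
    simp only [map_smul, LinearMap.smul_apply, smul_eq_mul] at this
    have : (c - d) * B y z = 0 := by linear_combination this
    exact (mul_eq_zero.mp this).resolve_left (sub_ne_zero.mpr hcd)
  let b := basisOfLinearIndependentOfCardEqFinrank' v
    (Module.End.eigenvectors_linearIndependent' _ μ hμ v hv) (by simp)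
  have hb (i) : b i = v i := by simp [b]
  -- An isotropic `v i` would be orthogonal to the whole eigenbasis.
  have hne (i) : B (v i) (v i) ≠ 0 := by
    intro h
    refine (hv i).2 (hnondeg.1 _ fun w => ?_)
    have : B (v i) = 0 := b.ext fun j => by
      rw [hb]
      rcases eq_or_ne i j with rfl | hij
      · exact h
      · exact horth _ _ (hμ.ne hij) _ _ (hLv i) (hLv j)
    rw [this]; rfl
  choose r hr using fun i => IsAlgClosed.exists_pow_nat_eq (B (v i) (v i)) (n := 2) (by norm_num)
  have hr0 (i) : r i ≠ 0 := fun h => hne i (by rw [← hr, h]; norm_num)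
  let e := b.isUnitSMul fun i => (inv_ne_zero (hr0 i)).isUnit
  have he' (i) : e i = (r i)⁻¹ • v i := by
    simp [e, ← hb, Module.Basis.isUnitSMul_apply]
  have hLe (i) : mu B T x (e i) = μ i • e i := by
    rw [he', mu_smul_snd, hLv, smul_comm]
  have he (i j) : B (e i) (e j) = if i = j then 1 else 0 := by
    split_ifs with h
    · subst h
      have := hr0 i
      simp [he', ← hr]
      field_simp
    · exact horth _ _ (hμ.ne h) _ _ (hLe i) (hLe j)
  have hmul (i j) : mu B T x (mu B T (e i) (e j)) = μ i • mu B T (e i) (e j) := by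
    rw [hT, hLe, mu_smul_fst]
  have hzero (i j k) (h : i ≠ k) : B (mu B T (e i) (e j)) (e k) = 0 :=
    horth _ _ (hμ.ne h) _ _ (hmul i j) (hLe k)
  have hTe : T = ∑ i, B (mu B T (e i) (e i)) (e i) • cube (e i) := by
    refine ext_of_form_mu he fun i j k => ?_
    rw [mu_sum_smul_cube, map_sum, LinearMap.sum_apply, Finset.sum_eq_single k]
    · simp only [map_smul, LinearMap.smul_apply, he, smul_eq_mul, if_true, mul_one]
      by_cases hik : i = k
      · subst hik
        by_cases hij : i = j
        · subst hij; simp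
        · rw [form_mu_right_comm, hzero _ _ _ hij]; simp [hij]
      · rw [hzero _ _ _ hik]; simp [Ne.symm hik]
    · intro l _ hl
      rw [map_smul, LinearMap.smul_apply, he l k, if_neg hl, smul_zero]
    · simp
  rw [hTe]
  exact isStronglyOdeco_sum_smul_cube _ (fun i => by simp [he]) fun i j h => by simp [he, h]

theorem charpolyDisc_ne_zero_sum_cube {n : ℕ} {e : Module.Basis (Fin n) ℂ V}
    (he : ∀ i j, B (e i) (e j) = if i = j then 1 else 0) :
    charpolyDisc (muBilin B (∑ i, cube (e i)) (∑ i : Fin n, ((i : ℕ) : ℂ) • e i)) ≠ 0 := by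
  refine charpolyDisc_ne_zero_of_basis e (d := fun i => ((i : ℕ) : ℂ))
    (Nat.cast_injective.comp Fin.val_injective) fun i => ?_
  rw [map_sum, LinearMap.sum_apply]
  simp [mu_sum_cube_basis he]

end DistinctEigenvalues

/-! ### The Cayley transform with denominators cleared -/

section Cayley

open Matrix

/-- Induction on the size: as a function of the first sign `s` the determinant is affine, with slope
the nonzero smaller determinant, so it cannot vanish at both `1` and `-1`. -/
theorem exists_sign_det_add_diagonal_ne_zero : ∀ {n : ℕ} (Q : Matrix (Fin n) (Fin n) ℂ),
    ∃ ε : Fin n → ℂ, (∀ i, ε i * ε i = 1) ∧ (Q + diagonal ε).det ≠ 0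
  | 0, Q => ⟨fun _ => 1, by simp, by simp⟩
  | n + 1, Q => by
    obtain ⟨ε, hε, hdet⟩ := exists_sign_det_add_diagonal_ne_zero (Q.submatrix Fin.succ Fin.succ)
    have hsub (s : ℂ) : (Q + diagonal (Fin.cons s ε : Fin (n + 1) → ℂ)).det =
        s * (Q.submatrix Fin.succ Fin.succ + diagonal ε).det +
          (Q + diagonal (Fin.cons 0 ε : Fin (n + 1) → ℂ)).det := by
      have hrow (j : Fin (n + 1)) (s : ℂ) :
          (Q + diagonal (Fin.cons s ε : Fin (n + 1) → ℂ)).submatrix Fin.succ j.succAbove =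
          (Q + diagonal (Fin.cons 0 ε : Fin (n + 1) → ℂ)).submatrix Fin.succ j.succAbove := by
        ext a b
        simp [diagonal_apply]
      have hcorner : (Q + diagonal (Fin.cons 0 ε : Fin (n + 1) → ℂ)).submatrix Fin.succ
          (Fin.succAbove 0) = Q.submatrix Fin.succ Fin.succ + diagonal ε := by
        ext a b
        simp [diagonal_apply]
      rw [det_succ_row_zero, det_succ_row_zero (Q + diagonal (Fin.cons 0 ε : Fin (n + 1) → ℂ)),
        Fin.sum_univ_succ, Fin.sum_univ_succ]
      simp only [hrow _ s, hcorner]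
      have h0 (j : Fin n) (s : ℂ) : (Q + diagonal (Fin.cons s ε : Fin (n + 1) → ℂ)) 0 j.succ =
          Q 0 j.succ := by
        simp [(Fin.succ_ne_zero j).symm]
      simp only [h0]
      simp
      ring
    have hcons (s : ℂ) (hs : s * s = 1) (i : Fin (n + 1)) :
        (Fin.cons s ε : Fin (n + 1) → ℂ) i * (Fin.cons s ε : Fin (n + 1) → ℂ) i = 1 := by
      induction i using Fin.cases <;> simp [hs, hε]
    by_contra! h
    have h₁ := h _ (hcons 1 (by norm_num))
    have h₂ := h _ (hcons (-1) (by norm_num))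
    rw [hsub] at h₁ h₂
    exact hdet (by linear_combination (h₁ - h₂) / 2)

/-- The skew-symmetric matrix with prescribed entries above the diagonal. -/
def skewMatrix (n : ℕ) : (OrderedPair n → ℂ) →ₗ[ℂ] Matrix (Fin n) (Fin n) ℂ where
  toFun p := Matrix.of fun i j =>
    if h : i < j then p ⟨(i, j), h.le⟩ else if h : j < i then - p ⟨(j, i), h.le⟩ else 0
  map_add' p q := by
    ext i j
    simp only [of_apply, Matrix.add_apply, Pi.add_apply]
    split_ifs <;> ring
  map_smul' c p := by
    ext i j
    simp only [of_apply, Matrix.smul_apply, Pi.smul_apply, smul_eq_mul, RingHom.id_apply]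
    split_ifs <;> ring

theorem skewMatrix_apply {n : ℕ} (p : OrderedPair n → ℂ) (i j : Fin n) : skewMatrix n p i j =
    if h : i < j then p ⟨(i, j), h.le⟩ else if h : j < i then - p ⟨(j, i), h.le⟩ else 0 := rfl

theorem transpose_skewMatrix {n : ℕ} (p : OrderedPair n → ℂ) :
    (skewMatrix n p)ᵀ = - skewMatrix n p := by
  ext i j
  rw [transpose_apply, Matrix.neg_apply, skewMatrix_apply, skewMatrix_apply]
  rcases lt_trichotomy i j with h | rfl | h
  · simp [h, h.not_gt]
  · simp
  · simp [h, h.not_gt]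

/-- `skewMatrix` ignores the diagonal parameters, which stay free to carry the coefficients of the
cubes. -/
theorem exists_skewMatrix_eq {n : ℕ} {A : Matrix (Fin n) (Fin n) ℂ} (hA : Aᵀ = -A)
    (c : Fin n → ℂ) :
    ∃ p : OrderedPair n → ℂ, skewMatrix n p = A ∧ ∀ k, p ⟨(k, k), le_rfl⟩ = c k := by
  have hA' (i j) : A j i = - A i j := congr_fun₂ hA i j
  refine ⟨fun q => if q.1.1 = q.1.2 then c q.1.1 else A q.1.1 q.1.2, ?_, fun k => by simp⟩
  ext i j
  rw [skewMatrix_apply]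
  rcases lt_trichotomy i j with h | rfl | h
  · simp [h, h.ne]
  · have := hA' i i
    simp
    linear_combination -this / 2
  · simp [h, h.not_gt, h.ne, hA' i j]

/-- The Cayley transform `(1 - A)(1 + A)⁻¹` multiplied by `det (1 + A)`. -/
def cayley {R : Type*} [CommRing R] {n : ℕ} (A : Matrix (Fin n) (Fin n) R) :
    Matrix (Fin n) (Fin n) R :=
  (1 - A) * (1 + A).adjugate

/-- For skew `A` transposition exchanges `1 + A` and `1 - A`, which commute and have equal
determinant. -/
theorem transpose_cayley_mul_cayley {n : ℕ} {A : Matrix (Fin n) (Fin n) ℂ} (hA : Aᵀ = -A) :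
    (cayley A)ᵀ * cayley A = ((1 + A).det ^ 2) • (1 : Matrix (Fin n) (Fin n) ℂ) := by
  have hdet : (1 - A).det = (1 + A).det := by
    rw [← det_transpose (1 + A), transpose_add, hA, transpose_one, sub_eq_add_neg]
  have hcomm : (1 + A) * (1 - A) = (1 - A) * (1 + A) := by noncomm_ring
  rw [cayley, transpose_mul, adjugate_transpose, transpose_add, transpose_sub, hA, transpose_one,
    sub_neg_eq_add, ← sub_eq_add_neg]
  calc (1 - A).adjugate * (1 + A) * ((1 - A) * (1 + A).adjugate)
      = (1 - A).adjugate * ((1 + A) * (1 - A)) * (1 + A).adjugate := by noncomm_ring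
    _ = ((1 - A).adjugate * (1 - A)) * ((1 + A) * (1 + A).adjugate) := by
      rw [hcomm]; noncomm_ring
    _ = _ := by
      rw [adjugate_mul, mul_adjugate, hdet, smul_mul_smul_comm, mul_one, sq]

/-- The Cayley transform is an involution, so the witness is `A = (1 - Q)(1 + Q)⁻¹`. With `R = (1 +
Q)⁻¹`, orthogonality gives `Rᵀ = QR`, whence skewness, while `1 + A = 2R` and `1 - A = 2QR`. -/
theorem exists_skew_cayley_eq {n : ℕ} {Q : Matrix (Fin n) (Fin n) ℂ} (hQ : Qᵀ * Q = 1)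
    (hdet : (1 + Q).det ≠ 0) :
    ∃ A : Matrix (Fin n) (Fin n) ℂ, Aᵀ = -A ∧ (1 + A).det ≠ 0 ∧ cayley A = (1 + A).det • Q := by
  have hu : IsUnit (1 + Q).det := hdet.isUnit
  set R := (1 + Q)⁻¹ with hR
  have h₁ : (1 + Q) * R = 1 := mul_nonsing_inv _ hu
  have h₂ : R * (1 + Q) = 1 := nonsing_inv_mul _ hu
  have hQ' : Q * Qᵀ = 1 := mul_eq_one_comm.mp hQ
  have hcomm : Q * R = R * Q := by
    have h₃ : R + Q * R = 1 := by rw [← h₁]; noncomm_ring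
    have h₄ : R + R * Q = 1 := by rw [← h₂]; noncomm_ring
    exact add_left_cancel (h₃.trans h₄.symm)
  have hRt : Rᵀ * (1 + Qᵀ) = 1 := by
    rw [← transpose_one, ← transpose_add, ← transpose_mul, h₁]
  have hRt' : Rᵀ = Q * R := by
    have : (1 + Qᵀ) * (Q * R) = 1 := by
      rw [← Matrix.mul_assoc, Matrix.add_mul, hQ, Matrix.one_mul, add_comm, h₁]
    calc Rᵀ = Rᵀ * ((1 + Qᵀ) * (Q * R)) := by rw [this, Matrix.mul_one]
      _ = Q * R := by rw [← Matrix.mul_assoc, hRt, Matrix.one_mul]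
  have hplus : 1 + (1 - Q) * R = 2 • R := by
    nth_rw 1 [← h₁]; noncomm_ring
  have hminus : 1 - (1 - Q) * R = 2 • (Q * R) := by
    nth_rw 1 [← h₁]; noncomm_ring
  have hunit : IsUnit (1 + (1 - Q) * R).det := by
    rw [hplus]
    refine (Matrix.isUnit_iff_isUnit_det _).mp ?_
    refine ⟨⟨2 • R, (1 / 2 : ℂ) • (1 + Q), ?_, ?_⟩, rfl⟩
    · rw [smul_mul_assoc, mul_smul_comm, h₂, ← Nat.cast_smul_eq_nsmul ℂ, smul_smul]; norm_num
    · rw [smul_mul_assoc, mul_smul_comm, h₁, ← Nat.cast_smul_eq_nsmul ℂ, smul_smul]; norm_num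
  refine ⟨(1 - Q) * R, ?_, hunit.ne_zero, ?_⟩
  · have : R * Q * (1 - Qᵀ) = R * Q - R * (Q * Qᵀ) := by noncomm_ring
    rw [transpose_mul, hRt', transpose_sub, transpose_one, hcomm, this, hQ', Matrix.sub_mul, hcomm]
    noncomm_ring
  · have : 2 • (Q * R) = Q * (1 + (1 - Q) * R) := by rw [hplus]; noncomm_ring
    rw [cayley, hminus, this, Matrix.mul_assoc, mul_adjugate]
    simp

theorem map_cayley {R S : Type*} [CommRing R] [CommRing S] {n : ℕ} (f : R →+* S)
    (A : Matrix (Fin n) (Fin n) R) : f.mapMatrix (cayley A) = cayley (f.mapMatrix A) := by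
  rw [cayley, map_mul, RingHom.map_adjugate, map_sub, map_add, map_one, cayley]

/-- The generic skew-symmetric matrix. -/
noncomputable def genericSkewMatrix (n : ℕ) :
    Matrix (Fin n) (Fin n) (polynomialFunctions (OrderedPair n → ℂ)) :=
  fun i j => ⟨_, dual_mem_polynomialFunctions
    (Matrix.entryLinearMap ℂ ℂ i j ∘ₗ skewMatrix n)⟩

/-- Evaluation of polynomial functions at a point. -/
def evalAt {W : Type*} [AddCommGroup W] [Module ℂ W] (w : W) : polynomialFunctions W →+* ℂ :=
  (Pi.evalRingHom (fun _ : W => ℂ) w).comp (polynomialFunctions W).val.toRingHom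

theorem evalAt_genericSkewMatrix {n : ℕ} (p : OrderedPair n → ℂ) :
    (evalAt p).mapMatrix (genericSkewMatrix n) = skewMatrix n p := rfl

theorem cayley_skewMatrix_mem {n : ℕ} (i j : Fin n) :
    (fun p => cayley (skewMatrix n p) i j) ∈ polynomialFunctions (OrderedPair n → ℂ) := by
  suffices (fun p => cayley (skewMatrix n p) i j) = (cayley (genericSkewMatrix n) i j).1 by
    rw [this]; exact (cayley (genericSkewMatrix n) i j).2
  ext p
  rw [← evalAt_genericSkewMatrix, ← map_cayley]
  rfl

theorem det_skewMatrix_mem {n : ℕ} :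
    (fun p => (1 + skewMatrix n p).det) ∈ polynomialFunctions (OrderedPair n → ℂ) := by
  suffices (fun p => (1 + skewMatrix n p).det) = (1 + genericSkewMatrix n).det.1 by
    rw [this]; exact (1 + genericSkewMatrix n).det.2
  ext p
  rw [← evalAt_genericSkewMatrix, ← map_one (evalAt p).mapMatrix, ← map_add, ← RingHom.map_det]
  rfl

end Cayley

/-! ### A polynomial parametrization dense in `Y` -/

section Parametrization

open Matrix

variable {V : Type*} [AddCommGroup V] [Module ℂ V] {B : LinearMap.BilinForm ℂ V} {n : ℕ}

/-- The vector whose coordinates form the `k`-th column of `Q`. -/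
noncomputable def column (e : Module.Basis (Fin n) ℂ V) (Q : Matrix (Fin n) (Fin n) ℂ)
    (k : Fin n) : V :=
  ∑ j, Q j k • e j

theorem column_smul (e : Module.Basis (Fin n) ℂ V) (c : ℂ) (Q : Matrix (Fin n) (Fin n) ℂ)
    (k : Fin n) : column e (c • Q) k = c • column e Q k := by
  simp [column, Finset.smul_sum, smul_smul]

theorem form_column {e : Module.Basis (Fin n) ℂ V}
    (he : ∀ i j, B (e i) (e j) = if i = j then 1 else 0) (P Q : Matrix (Fin n) (Fin n) ℂ)
    (i k : Fin n) : B (column e P i) (column e Q k) = (Pᵀ * Q) i k := by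
  simp [column, he, Matrix.mul_apply, mul_comm]

theorem isStronglyOdeco_sum_column {e : Module.Basis (Fin n) ℂ V}
    (he : ∀ i j, B (e i) (e j) = if i = j then 1 else 0) {Q : Matrix (Fin n) (Fin n) ℂ} {d : ℂ}
    (hd : d ≠ 0) (hQ : Qᵀ * Q = d • (1 : Matrix (Fin n) (Fin n) ℂ)) (c : Fin n → ℂ) :
    IsStronglyOdeco B (∑ k, c k • cube (column e Q k)) :=
  isStronglyOdeco_sum_smul_cube c (fun i => by simp [form_column he, hQ, hd])
    fun i j h => by simp [form_column he, hQ, h]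

theorem cube_column_mem {P : Type*} [AddCommGroup P] [Module ℂ P] (e : Module.Basis (Fin n) ℂ V)
    (φ : Module.Dual ℂ (symCube V)) {Q : P → Matrix (Fin n) (Fin n) ℂ}
    (hQ : ∀ i j, (fun p => Q p i j) ∈ polynomialFunctions P) (k : Fin n) :
    (fun p => φ (cube (column e (Q p) k))) ∈ polynomialFunctions P := by
  obtain ⟨φ', rfl⟩ := φ.exists_extend
  have (p : P) : (φ' ∘ₗ (symCube V).subtype) (cube (column e (Q p) k)) =
      ∑ i, ∑ j, ∑ l, Q p i k * (Q p j k * (Q p l k * φ' (e l ⊗ₜ[ℂ] (e j ⊗ₜ[ℂ] e i)))) := by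
    simp only [LinearMap.comp_apply, Submodule.subtype_apply, cube, column,
      TensorProduct.sum_tmul, TensorProduct.tmul_sum, ← TensorProduct.smul_tmul',
      TensorProduct.tmul_smul, map_sum, map_smul, smul_eq_mul, Finset.mul_sum]
  simp only [this]
  refine sum_mem_polynomialFunctions _ fun i _ => sum_mem_polynomialFunctions _ fun j _ =>
    sum_mem_polynomialFunctions _ fun l _ => ?_
  exact mul_mem (hQ i k) (mul_mem (hQ j k) (mul_mem (hQ l k) (const_mem_polynomialFunctions _)))

/-- A polynomial parametrization of the strongly odeco tensors by means of Cayley transforms. -/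
noncomputable def odecoParam (e : Module.Basis (Fin n) ℂ V) (p : OrderedPair n → ℂ) : symCube V :=
  ∑ k, p ⟨(k, k), le_rfl⟩ • cube (column e (cayley (skewMatrix n p)) k)

theorem odecoParam_mem (e : Module.Basis (Fin n) ℂ V) (φ : Module.Dual ℂ (symCube V)) :
    (fun p => φ (odecoParam e p)) ∈ polynomialFunctions (OrderedPair n → ℂ) := by
  simp only [odecoParam, map_sum, map_smul, smul_eq_mul]
  exact sum_mem_polynomialFunctions _ fun k _ => mul_mem
    (dual_mem_polynomialFunctions (LinearMap.proj _ : (OrderedPair n → ℂ) →ₗ[ℂ] ℂ))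
    (cube_column_mem e φ cayley_skewMatrix_mem k)

theorem isStronglyOdeco_odecoParam {e : Module.Basis (Fin n) ℂ V}
    (he : ∀ i j, B (e i) (e j) = if i = j then 1 else 0) {p : OrderedPair n → ℂ}
    (hp : (1 + skewMatrix n p).det ≠ 0) : IsStronglyOdeco B (odecoParam e p) :=
  isStronglyOdeco_sum_column he (pow_ne_zero 2 hp)
    (transpose_cayley_mul_cayley (transpose_skewMatrix p)) _

/-- An orthogonal matrix may have eigenvalue `-1` and escape the Cayley transform; changing signs of
its columns avoids this, and the coefficients absorb the signs. -/
theorem exists_odecoParam_eq {e : Module.Basis (Fin n) ℂ V}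
    (he : ∀ i j, B (e i) (e j) = if i = j then 1 else 0) {w : Fin n → V}
    (hw : ∀ i j, B (w i) (w j) = if i = j then 1 else 0) (d : Fin n → ℂ) :
    ∃ p, odecoParam e p = ∑ i, d i • cube (w i) := by
  let Q : Matrix (Fin n) (Fin n) ℂ := Matrix.of fun j i => e.repr (w i) j
  have hcol (k) : column e Q k = w k := e.sum_repr (w k)
  have hQ : Qᵀ * Q = 1 := by
    ext i j
    rw [← form_column he, hcol, hcol, hw, Matrix.one_apply]
  obtain ⟨ε, hε, hdet⟩ := exists_sign_det_add_diagonal_ne_zero Q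
  have hε0 (i) : ε i ≠ 0 := fun h => by simpa [h] using hε i
  have hdd : diagonal ε * diagonal ε = 1 := by
    rw [diagonal_mul_diagonal]; simp [hε]
  obtain ⟨A, hA, hA1, hcay⟩ := exists_skew_cayley_eq (Q := Q * diagonal ε)
    (by rw [transpose_mul, Matrix.mul_assoc, ← Matrix.mul_assoc Qᵀ, hQ, Matrix.one_mul,
      diagonal_transpose, hdd])
    (by
      rw [← hdd, ← Matrix.add_mul, det_mul, add_comm]
      refine mul_ne_zero hdet ?_
      rw [det_diagonal, Finset.prod_ne_zero_iff]
      exact fun i _ => hε0 i)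
  -- Column `k` of `cayley A` is `det(1 + A) ε_k w_k`, so its cube carries the third power of that
  -- scalar.
  obtain ⟨p, hpA, hpc⟩ := exists_skewMatrix_eq hA fun k => d k * (((1 + A).det * ε k) ^ 3)⁻¹
  refine ⟨p, Finset.sum_congr rfl fun k _ => ?_⟩
  have : column e (cayley A) k = ((1 + A).det * ε k) • w k := by
    rw [hcay, column_smul, ← hcol k, mul_smul]
    congr 1
    simp [column, Finset.smul_sum, smul_smul, mul_comm]
  rw [hpA, hpc, this, cube_smul, smul_smul, mul_assoc, inv_mul_cancel₀, mul_one]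
  exact pow_ne_zero 3 (mul_ne_zero hA1 (hε0 k))

theorem IsStronglyOdeco.exists_odecoParam [FiniteDimensional ℂ V] (hsymm : B.IsSymm)
    (hnondeg : B.Nondegenerate) {e : Module.Basis (Fin (Module.finrank ℂ V)) ℂ V}
    (he : ∀ i j, B (e i) (e j) = if i = j then 1 else 0) {T : symCube V}
    (hT : IsStronglyOdeco B T) : ∃ p, odecoParam e p = T := by
  obtain ⟨k, u, c, hu, rfl⟩ := hT.exists_orthonormal
  obtain ⟨w, d, hw, hd⟩ := exists_orthonormal_extension hsymm hnondeg u c hu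
  rw [hd]
  exact exists_odecoParam_eq he hw d

/-- A polynomial function vanishes on the strongly odeco tensors if and only if its pullback along
the parametrization vanishes. -/
theorem forall_isStronglyOdeco_eq_zero_iff [FiniteDimensional ℂ V] (hsymm : B.IsSymm)
    (hnondeg : B.Nondegenerate) {e : Module.Basis (Fin (Module.finrank ℂ V)) ℂ V}
    (he : ∀ i j, B (e i) (e j) = if i = j then 1 else 0) {f : symCube V → ℂ}
    (hf : f ∈ polynomialFunctions (symCube V)) :
    (∀ T, IsStronglyOdeco B T → f T = 0) ↔ ∀ p, f (odecoParam e p) = 0 := by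
  constructor
  · intro h
    -- The pullback of `f` vanishes wherever `det(1 + S) ≠ 0`. This determinant is `1` at the
    -- origin, so it is not the zero polynomial and can be cancelled.
    rcases eq_zero_of_mul_eq_zero det_skewMatrix_mem
      (comp_mem_polynomialFunctions (odecoParam_mem e) hf) (fun p => by
        by_cases hp : (1 + skewMatrix _ p).det = 0
        · simp [hp]
        · simp [h _ (isStronglyOdeco_odecoParam he hp)]) with h0 | h0
    · have := congr_fun h0 0
      simp at this
    · exact congr_fun h0
  · intro h T hT
    obtain ⟨p, rfl⟩ := hT.exists_odecoParam hsymm hnondeg he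
    exact h p

theorem mem_Y_iff [FiniteDimensional ℂ V] (hsymm : B.IsSymm)
    (hnondeg : B.Nondegenerate) {e : Module.Basis (Fin (Module.finrank ℂ V)) ℂ V}
    (he : ∀ i j, B (e i) (e j) = if i = j then 1 else 0) {T : symCube V} :
    T ∈ Y B ↔ ∀ f ∈ polynomialFunctions (symCube V), (∀ p, f (odecoParam e p) = 0) → f T = 0 := by
  rw [Y, mem_zariskiClosure_iff]
  refine forall₂_congr fun f hf => ?_
  rw [← forall_isStronglyOdeco_eq_zero_iff hsymm hnondeg he hf]
  rfl

theorem odecoParam_mem_Y [FiniteDimensional ℂ V] (hsymm : B.IsSymm)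
    (hnondeg : B.Nondegenerate) {e : Module.Basis (Fin (Module.finrank ℂ V)) ℂ V}
    (he : ∀ i j, B (e i) (e j) = if i = j then 1 else 0) (p) : odecoParam e p ∈ Y B :=
  (mem_Y_iff hsymm hnondeg he).mpr fun _ _ h => h p

end Parametrization

/-! ### `Y` as an irreducible component of `X` -/

section Component

variable {V : Type*} [AddCommGroup V] [Module ℂ V] {B : LinearMap.BilinForm ℂ V}

/-- Pulled back to the parameter space, a product vanishing on these tensors has a vanishing factor.
-/
theorem isPreirreducible_stronglyOdeco [FiniteDimensional ℂ V] (hsymm : B.IsSymm)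
    (hnondeg : B.Nondegenerate) :
    @IsPreirreducible _ (zariskiTopology (symCube V)) {T | IsStronglyOdeco B T} := by
  let _ := zariskiTopology (symCube V)
  obtain ⟨e, he⟩ := exists_orthonormalBasis hsymm hnondeg
  rw [isPreirreducible_iff_isClosed_union_isClosed]
  intro Z₁ Z₂ h₁ h₂ hsub
  obtain ⟨S₁, hS₁, rfl⟩ := isClosed_zariski_iff.mp h₁
  obtain ⟨S₂, hS₂, rfl⟩ := isClosed_zariski_iff.mp h₂
  by_contra! hcon
  obtain ⟨⟨T₁, hT₁, hT₁'⟩, T₂, hT₂, hT₂'⟩ := hcon.imp Set.not_subset.mp Set.not_subset.mp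
  simp only [zeroLocus, Set.mem_ofPred_eq, not_forall] at hT₁' hT₂'
  obtain ⟨f, hf, hfT⟩ := hT₁'
  obtain ⟨g, hg, hgT⟩ := hT₂'
  have hprod := (forall_isStronglyOdeco_eq_zero_iff hsymm hnondeg he
    (mul_mem (hS₁ hf) (hS₂ hg))).mp fun T hT => by
      rcases hsub hT with h | h
      · simp [h f hf]
      · simp [h g hg]
  rcases eq_zero_of_mul_eq_zero (comp_mem_polynomialFunctions (odecoParam_mem e) (hS₁ hf))
    (comp_mem_polynomialFunctions (odecoParam_mem e) (hS₂ hg)) hprod with h | h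
  · exact hfT ((forall_isStronglyOdeco_eq_zero_iff hsymm hnondeg he (hS₁ hf)).mpr
      (congr_fun h) T₁ hT₁)
  · exact hgT ((forall_isStronglyOdeco_eq_zero_iff hsymm hnondeg he (hS₂ hg)).mpr
      (congr_fun h) T₂ hT₂)

theorem isIrreducibleComponentOf_Y [FiniteDimensional ℂ V] (hsymm : B.IsSymm)
    (hnondeg : B.Nondegenerate) : IsIrreducibleComponentOf (Y B) (X B) := by
  let _ := zariskiTopology (symCube V)
  obtain ⟨e, he⟩ := exists_orthonormalBasis hsymm hnondeg
  have hE : IsStronglyOdeco B (∑ i, cube (e i)) := by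
    simpa using isStronglyOdeco_sum_smul_cube (B := B) (fun _ => 1) (v := e)
      (fun i => by simp [he]) fun i j h => by simp [he, h]
  have hYX : Y B ⊆ X B := closure_minimal (fun T hT => hT.mem_X) isClosed_X
  have hirr : IsIrreducible (Y B) :=
    ⟨⟨_, subset_closure hE⟩, (isPreirreducible_stronglyOdeco hsymm hnondeg).closure⟩
  refine ⟨hYX, ⟨?_, ?_⟩⟩
  · refine ⟨⟨⟨_, hE.mem_X⟩, subset_closure hE⟩, ?_⟩
    rintro _ _ ⟨u, hu, rfl⟩ ⟨v, hv, rfl⟩ ⟨S, hS, hSu⟩ ⟨T, hT, hTv⟩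
    obtain ⟨R, hR, hRuv⟩ := hirr.2 u v hu hv ⟨S, hS, hSu⟩ ⟨T, hT, hTv⟩
    exact ⟨⟨R, hYX hR⟩, hR, hRuv⟩
  · intro Z hZ hYZ T hTZ
    have hZ' : IsIrreducible (Subtype.val '' Z) := hZ.image _ continuous_subtype_val.continuousOn
    -- The element `∑ i • e i` acts on the algebra of `E` with eigenvalues `0, …, n-1`, so `q` does
    -- not vanish at `E`.
    let q : symCube V → ℂ := fun T => charpolyDisc (muBilin B T (∑ i : Fin (Module.finrank ℂ V), ((i : ℕ) : ℂ) • e i))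
    have hq : IsClosed {T | q T = 0} := isClosed_zariski_iff.mpr ⟨{q}, by
      simpa using charpolyDisc_mem_polynomialFunctions _, by ext; simp [zeroLocus]⟩
    rcases isPreirreducible_iff_isClosed_union_isClosed.mp hZ'.2 (Y B) {T | q T = 0}
      isClosed_closure hq (by
        rintro _ ⟨T, -, rfl⟩
        by_cases h : q T = 0
        · exact Or.inr h
        · exact Or.inl (subset_closure
            (isStronglyOdeco_of_charpolyDisc_ne_zero hsymm hnondeg T.2 h))) with h | h
    · exact h ⟨T, hTZ, rfl⟩
    · exact absurd (h ⟨⟨_, hE.mem_X⟩, hYZ (subset_closure hE), rfl⟩)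
        (charpolyDisc_ne_zero_sum_cube he)

end Component

/-! ### The dimension of `Y` -/

section Dimension

open Matrix

theorem polynomial_eq_zero_of_eventually {ι : Type*} [Fintype ι] (p : MvPolynomial ι ℂ) (x : ι → ℂ)
    (h : ∀ᶠ y in nhds x, MvPolynomial.eval y p = 0) : p = 0 := by
  obtain ⟨ε, hε, hball⟩ := Metric.eventually_nhds_iff_ball.mp h
  refine MvPolynomial.funext_set (fun i => Metric.ball (x i) ε)
    (fun i => (infinite_of_mem_nhds (x i) (Metric.ball_mem_nhds _ hε))) fun y hy => ?_
  rw [map_zero]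
  refine hball y ?_
  exact Metric.mem_ball.mpr ((dist_pi_lt_iff hε).mpr fun i => hy i trivial)

attribute [local instance] Matrix.linftyOpNormedRing Matrix.linftyOpNormedAlgebra

variable {n : ℕ}

/-- Near `S = 0`, `(1 - S)(1 + S)⁻¹ = 1 - 2S + O(S²)`. -/
theorem hasStrictFDerivAt_cayleyQuotient (i j : Fin n) (p₀ : OrderedPair n → ℂ)
    (hp₀ : skewMatrix n p₀ = 0) :
    HasStrictFDerivAt
      (fun p => ((1 - skewMatrix n p) * Ring.inverse (1 + skewMatrix n p)) i j)
      ((-2 : ℂ) • LinearMap.toContinuousLinearMap (Matrix.entryLinearMap ℂ ℂ i j ∘ₗ skewMatrix n)) p₀ := by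
  let S : (OrderedPair n → ℂ) →L[ℂ] Matrix (Fin n) (Fin n) ℂ :=
    LinearMap.toContinuousLinearMap (skewMatrix n)
  let E : Matrix (Fin n) (Fin n) ℂ →L[ℂ] ℂ :=
    LinearMap.toContinuousLinearMap (Matrix.entryLinearMap ℂ ℂ i j)
  have hS : HasStrictFDerivAt (fun p => skewMatrix n p) S p₀ := S.hasStrictFDerivAt
  have h₁ : HasStrictFDerivAt (fun p => 1 + skewMatrix n p) S p₀ := hS.const_add 1
  have h₂ : HasStrictFDerivAt (fun p => 1 - skewMatrix n p) (-S) p₀ := hS.const_sub 1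
  have hinv := hasStrictFDerivAt_ringInverse (𝕜 := ℂ) (1 : (Matrix (Fin n) (Fin n) ℂ)ˣ)
  have h₃ := HasStrictFDerivAt.comp p₀ (g := Ring.inverse) (by simpa [hp₀] using hinv) h₁
  have h₄ := E.hasStrictFDerivAt.comp p₀ (h₂.mul' h₃)
  refine h₄.congr_fderiv ?_
  ext q
  rw [hp₀, sub_zero, add_zero, Ring.inverse_one]
  change (1 * -(1 * S q * 1) + (-S q) * 1 : Matrix (Fin n) (Fin n) ℂ) i j =
    -2 * (S q : Matrix (Fin n) (Fin n) ℂ) i j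
  simp
  ring

theorem cayleyQuotient_eq (A : Matrix (Fin n) (Fin n) ℂ) :
    (1 - A) * Ring.inverse (1 + A) = ((1 + A).det)⁻¹ • cayley A := by
  rw [← Matrix.nonsing_inv_eq_ringInverse, Matrix.inv_def, Ring.inverse_eq_inv', mul_smul_comm, cayley]

/-- The coordinates at the index triples `(i, i, j)`, `i ≤ j`, of a combination of the cubes of the
columns of a Cayley transform. -/
noncomputable def cayleyCoords (n : ℕ) (p : OrderedPair n → ℂ) (q : OrderedPair n) : ℂ :=
  ∑ k, p ⟨(k, k), le_rfl⟩ *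
    (((1 - skewMatrix n p) * Ring.inverse (1 + skewMatrix n p)) q.1.1 k *
      ((1 - skewMatrix n p) * Ring.inverse (1 + skewMatrix n p)) q.1.1 k *
      ((1 - skewMatrix n p) * Ring.inverse (1 + skewMatrix n p)) q.1.2 k)

/-- The parameters of `∑ eᵢ ⊗ eᵢ ⊗ eᵢ`. -/
def basePoint (n : ℕ) (q : OrderedPair n) : ℂ := if q.1.1 = q.1.2 then 1 else 0

theorem skewMatrix_basePoint : skewMatrix n (basePoint n) = 0 := by
  ext i j
  rw [skewMatrix_apply]
  split_ifs with h h'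
  · simp [basePoint, h.ne]
  · simp [basePoint, h'.ne]
  · rfl

/-- To first order at the identity only the summand `k = i` contributes to the coordinate `(i,i,j)`.
It gives the coefficient's increment if `i = j`, and `-2 S_ji = 2 S_ij` if `i < j`, so the
derivative is diagonal with entries `1` and `2`. -/
theorem hasStrictFDerivAt_cayleyCoords :
    HasStrictFDerivAt (cayleyCoords n)
      (ContinuousLinearMap.pi fun q : OrderedPair n => (if q.1.1 = q.1.2 then (1 : ℂ) else 2) •
        ContinuousLinearMap.proj (R := ℂ) (φ := fun _ : OrderedPair n => ℂ) q) (basePoint n) := by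
  rw [hasStrictFDerivAt_pi]
  rintro ⟨⟨i, j⟩, hij⟩
  have hG (i j : Fin n) := hasStrictFDerivAt_cayleyQuotient i j (basePoint n) skewMatrix_basePoint
  have hp (q : OrderedPair n) := (ContinuousLinearMap.proj (R := ℂ)
    (φ := fun _ : OrderedPair n => ℂ) q).hasStrictFDerivAt (x := basePoint n)
  have := HasStrictFDerivAt.fun_sum (u := Finset.univ) fun (k : Fin n) _ =>
    (hp ⟨(k, k), le_rfl⟩).mul (((hG i k).mul (hG i k)).mul (hG j k))
  refine this.congr_fderiv ?_
  ext v
  simp [skewMatrix_basePoint, basePoint]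
  rw [Finset.sum_eq_single i (fun k _ hk => by simp [Matrix.one_apply_ne hk.symm]) (by simp)]
  rcases hij.eq_or_lt with h | h
  · obtain rfl : i = j := h
    simp [skewMatrix_apply]
  · have h' : i < j := h
    simp [skewMatrix_apply, h', h'.not_gt, h'.ne, Matrix.one_apply_ne h'.ne']

/-- The derivative at the base point is surjective, so the image contains a neighbourhood, on which
`P` vanishes. -/
theorem algebraicIndependent_cayleyCoords {P : MvPolynomial (OrderedPair n) ℂ}
    (hP : ∀ p, MvPolynomial.eval (cayleyCoords n p) P = 0) : P = 0 := by
  refine polynomial_eq_zero_of_eventually P (cayleyCoords n (basePoint n)) ?_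
  rw [← hasStrictFDerivAt_cayleyCoords.map_nhds_eq_of_surj]
  · exact Filter.eventually_map.mpr (Filter.Eventually.of_forall hP)
  · rw [LinearMap.range_eq_top]
    intro v
    refine ⟨fun q => (if q.1.1 = q.1.2 then (1 : ℂ) else 2)⁻¹ * v q, ?_⟩
    ext q
    by_cases h : q.1.1 = q.1.2 <;> simp [h]

variable {V : Type*} [AddCommGroup V] [Module ℂ V] {B : LinearMap.BilinForm ℂ V}

theorem exists_form_mu_odecoParam {e : Module.Basis (Fin n) ℂ V}
    (he : ∀ i j, B (e i) (e j) = if i = j then 1 else 0) (p : OrderedPair n → ℂ) :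
    ∃ p', ∀ q : OrderedPair n, B (mu B (odecoParam e p') (e q.1.1) (e q.1.1)) (e q.1.2) =
      cayleyCoords n p q := by
  set d := (1 + skewMatrix n p).det with hd
  -- The factor `d⁻¹ ^ 3` turns cubes of columns of `cayley` into cubes of columns of the actual
  -- quotient. For `d = 0` both sides are zero, as `d⁻¹` and `Ring.inverse` then take the value
  -- zero.
  let p' : OrderedPair n → ℂ := fun q => if q.1.1 = q.1.2 then d⁻¹ ^ 3 * p q else p q
  have hp' : skewMatrix n p' = skewMatrix n p := by
    ext i j
    rw [skewMatrix_apply, skewMatrix_apply]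
    split_ifs with h h'
    · simp [p', h.ne]
    · simp [p', h'.ne]
    · rfl
  have hcol (Q : Matrix (Fin n) (Fin n) ℂ) (i k : Fin n) : B (column e Q k) (e i) = Q i k := by
    simp [column, he]
  refine ⟨p', fun q => ?_⟩
  rw [odecoParam, mu_sum_smul_cube, cayleyCoords, map_sum, LinearMap.sum_apply]
  refine Finset.sum_congr rfl fun k _ => ?_
  rw [hp', cayleyQuotient_eq, ← hd]
  simp only [map_smul, LinearMap.smul_apply, hcol, smul_eq_mul, Matrix.smul_apply, p', if_true]
  ring

theorem isDomain_polynomialFunctions {ι : Type*} [Finite ι] :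
    IsDomain (polynomialFunctions (ι → ℂ)) := by
  have : NoZeroDivisors (polynomialFunctions (ι → ℂ)) := ⟨fun {f g} h => by
    rcases eq_zero_of_mul_eq_zero f.2 g.2 (fun x => congr_fun (congrArg Subtype.val h) x) with h | h
    · exact Or.inl (Subtype.ext h)
    · exact Or.inr (Subtype.ext h)⟩
  exact NoZeroDivisors.to_isDomain _

/-- Pullback along `odecoParam` embeds the coordinate ring in a polynomial ring with `binom(n+1,2)`
variables; the functions `T_iij`, `i ≤ j`, are as many algebraically independent elements. -/
theorem varietyDim_Y [FiniteDimensional ℂ V] (hsymm : B.IsSymm) (hnondeg : B.Nondegenerate) :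
    varietyDim (Y B) = (((Module.finrank ℂ V + 1).choose 2 : ℕ) : WithBot ℕ∞) := by
  obtain ⟨e, he⟩ := exists_orthonormalBasis hsymm hnondeg
  let P := OrderedPair (Module.finrank ℂ V) → ℂ
  let pull : (Y B → ℂ) →ₐ[ℂ] (P → ℂ) :=
    { toFun := fun h p => h ⟨odecoParam e p, odecoParam_mem_Y hsymm hnondeg he p⟩
      map_one' := rfl
      map_mul' := fun _ _ => rfl
      map_zero' := rfl
      map_add' := fun _ _ => rfl
      commutes' := fun _ => rfl }
  let f : coordinateRing (Y B) →ₐ[ℂ] polynomialFunctions P :=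
    (pull.comp (coordinateRing (Y B)).val).codRestrict _ fun h => by
      obtain ⟨F, hF, hFh⟩ := mem_coordinateRing_iff.mp h.2
      have : (pull.comp (coordinateRing (Y B)).val) h = fun p => F (odecoParam e p) :=
        funext fun p => hFh _
      rw [this]
      exact comp_mem_polynomialFunctions (odecoParam_mem e) hF
  have hf : Function.Injective f := by
    rw [injective_iff_map_eq_zero]
    intro h hh
    obtain ⟨F, hF, hFh⟩ := mem_coordinateRing_iff.mp h.2
    refine Subtype.ext (funext fun z => ?_)
    rw [hFh]
    refine (mem_Y_iff hsymm hnondeg he).mp z.2 F hF fun p => ?_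
    have := congr_fun (congrArg Subtype.val hh) p
    exact (hFh _).symm.trans this
  have := isDomain_polynomialFunctions (ι := OrderedPair (Module.finrank ℂ V))
  have : IsDomain (coordinateRing (Y B)) := hf.isDomain f.toRingHom
  have := finiteType_coordinateRing (Y B)
  let x (q : OrderedPair (Module.finrank ℂ V)) : coordinateRing (Y B) :=
    ⟨fun z => (B.flip (e q.1.2) ∘ₗ muLeft B (e q.1.1) (e q.1.1)) z,
      Algebra.subset_adjoin ⟨_, rfl⟩⟩
  have hx : AlgebraicIndependent ℂ x := by
    rw [algebraicIndependent_iff]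
    intro p hp
    refine algebraicIndependent_cayleyCoords fun a => ?_
    obtain ⟨a', ha'⟩ := exists_form_mu_odecoParam he a
    let ev : coordinateRing (Y B) →ₐ[ℂ] ℂ := (Pi.evalAlgHom ℂ (fun _ : Y B => ℂ)
      ⟨odecoParam e a', odecoParam_mem_Y hsymm hnondeg he a'⟩).comp (coordinateRing (Y B)).val
    have hev : (fun q => ev (x q)) = cayleyCoords _ a := funext ha'
    rw [← hev, ← MvPolynomial.aeval_eq_eval, ← MvPolynomial.comp_aeval_apply]
    rw [hp, map_zero]
  rw [varietyDim, ringKrullDim_eq_card_of_algebraicIndependent f hf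
    ((mvPolynomialToFunctions _).codRestrict _ mvPolynomialToFunctions_mem)
    (fun g => by
      obtain ⟨p, hp⟩ := exists_mvPolynomial_of_mem g.2
      exact ⟨p, Subtype.ext hp⟩) hx, card_orderedPair]

end Dimension

end Odeco

/-- For a nondegenerate symmetric bilinear form `B` on an `n`-dimensional complex vector space `V`,
`Y(V)` is an irreducible component of `X(V)`; its dimension is `n(n+1)/2`, which is also the
dimension of the tangent space of `X(V)` at `∑ eᵢ ⊗ eᵢ ⊗ eᵢ` for every orthonormal basis `e`. -/
theorem mainTheorem4 {V : Type*} [AddCommGroup V] [Module ℂ V] [FiniteDimensional ℂ V]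
    (B : LinearMap.BilinForm ℂ V) (hsymm : B.IsSymm) (hnondeg : B.Nondegenerate) :
    Odeco.IsIrreducibleComponentOf (Odeco.Y B) (Odeco.X B) ∧
    Odeco.varietyDim (Odeco.Y B) = (((Module.finrank ℂ V + 1).choose 2 : ℕ) : WithBot ℕ∞) ∧
    ∀ (n : ℕ) (e : Module.Basis (Fin n) ℂ V), (∀ i j, B (e i) (e j) = if i = j then 1 else 0) →
      Module.finrank ℂ (Odeco.tangentSpaceX B (∑ i, Odeco.cube (e i))) = (n + 1).choose 2 := by
  exact ⟨Odeco.isIrreducibleComponentOf_Y hsymm hnondeg, Odeco.varietyDim_Y hsymm hnondeg,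
    fun _ _ he => Odeco.finrank_tangentSpaceX hsymm he⟩
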